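/- **Theorem 4.4.** For $\alpha,\beta,\upsilon>0$, $\sigma=\sqrt{\upsilon}$ and $\delta,\mu\in\mathbb R$, let $\mathrm{BGGL}(\alpha,\beta,\delta,\mu,\sigma)$ be the law of $(X,\ \delta+\mu X+\sigma\sqrt X\,Z)$, where $X$ has the gamma density $\frac{\beta^\alpha}{\Gamma(\alpha)}x^{\alpha-1}e^{-\beta x}$, $x>0$, and $Z\sim N(0,1)$ is independent of $X$; its density is $$f(x,y)=\frac1{\sqrt{2\pi}}\frac1{\sqrt\upsilon}\frac{\beta^\alpha}{\Gamma(\alpha)}x^{\alpha-3/2}\exp\left[-\beta x-\frac{(y-\delta-\mu x)^2}{2\upsilon x}\right],\qquad x>0,\ y\in\mathbb R .$$ Let $(X_i,Y_i)_{i\ge1}$ be i.i.d. from $\mathrm{BGGL}(1,\beta,\delta,\mu,\sigma)$ with $\beta,\sigma>0$, $\delta,\mu\in\mathbb R$, and put $\boldsymbol\theta=(1,\beta,\delta,\mu,\sigma^2)$. Let $\hat{\boldsymbol\theta}_n=(\hat\alpha_n,\hat\beta_n,\hat\delta_n,\hat\mu_n,\hat\upsilon_n)$ be the maximum likelihood estimator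 of all five parameters $(\alpha,\beta,\delta,\mu,\upsilon)$ based on the first $n$ observations, that is, any random vector which, almost surely, maximizes the log-likelihood $\sum_{i=1}^n\ln f(X_i,Y_i)$ over $\{(\alpha,\beta,\delta,\mu,\upsilon):\alpha,\beta,\upsilon>0,\ \delta,\mu\in\mathbb R\}$ whenever a maximizer exists (it may be arbitrary otherwise). Then, as $n\to\infty$, $$\sqrt n\,\mathrm{diag}(1,1,\sqrt{\ln n},1,1)\,(\hat{\boldsymbol\theta}_n-\boldsymbol\theta)^\top\ \xrightarrow{d}\ (W_\alpha,W_\beta,W_\delta,W_\mu,W_\upsilon)^\top,$$ where the four blocks $(W_\alpha,W_\beta)$, $W_\delta$, $W_\mu$, $W_\upsilon$ are independent and $$(W_\alpha,W_\beta)^\top\sim N_2(\mathbf 0,\boldsymbol\Sigma_{1,\beta}),\quad W_\delta\sim N(0,\sigma^2/\beta),\quad W_\mu\sim N(0,\sigma^2\beta),\quad W_\upsilon\sim N(0,2\sigma^4),$$ $$\boldsymbol\Sigma_{1,\beta}=[\psi'(1)-1]^{-1}\begin{bmatrix}1&\beta\\ \beta&\beta^2\psi'(1)\end{bmatrix},\qquad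 \psi=(\ln\Gamma)'.$$ Moreover, $\dfrac1{n\ln n}\displaystyle\sum_{i=1}^n\frac1{X_i}\xrightarrow{d}\beta$ as $n\to\infty$. -/

import Mathlib

open MeasureTheory ProbabilityTheory Filter Matrix

namespace BGGL

noncomputable section

/-- The distribution `BGGL(α, β, δ, μ, σ)`: the law of `(X, δ + μ X + σ √X Z)`, where `X` has the
gamma distribution with shape `α` and rate `β` (density proportional to `x ^ (α - 1) * exp (-β x)`
on the positive half-line) and `Z` is standard normal, independent of `X`. -/
def law (α β δ μ σ : ℝ) : Measure (ℝ × ℝ) :=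
  ((gammaMeasure α β).prod (gaussianReal 0 1)).map
    (fun p => (p.1, δ + μ * p.1 + σ * Real.sqrt p.1 * p.2))

/-- The joint density of `BGGL(α, β, δ, μ, σ)` with `σ = √υ`. -/
def density (α β δ μ υ x y : ℝ) : ℝ :=
  if 0 < x then
    1 / Real.sqrt (2 * Real.pi) * (1 / Real.sqrt υ) * (β ^ α / Real.Gamma α) * x ^ (α - 3 / 2) *
      Real.exp (-(β * x + (y - δ - μ * x) ^ 2 / (2 * υ * x)))
  else 0

/-- The parameter space: vectors `(α, β, δ, μ, υ)` with `α, β, υ > 0` and `δ, μ` real. -/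
def paramSpace : Set (Fin 5 → ℝ) :=
  {θ | 0 < θ 0 ∧ 0 < θ 1 ∧ 0 < θ 4}

/-- The log-likelihood of the parameter `θ = (α, β, δ, μ, υ)` given the first `n` terms of the
sequence of observations `(x i, y i)`. -/
def logLikelihood (n : ℕ) (x y : ℕ → ℝ) (θ : Fin 5 → ℝ) : ℝ :=
  ∑ i ∈ Finset.range n, Real.log (density (θ 0) (θ 1) (θ 2) (θ 3) (θ 4) (x i) (y i))

/-- `θ` is a maximum likelihood estimate from the first `n` observations: it lies in the parameter
space and maximizes the log-likelihood over the parameter space. -/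
def IsMLE (n : ℕ) (x y : ℕ → ℝ) (θ : Fin 5 → ℝ) : Prop :=
  θ ∈ paramSpace ∧ IsMaxOn (logLikelihood n x y) paramSpace θ

/-- The digamma function `ψ = (ln Γ)'` on the reals. -/
def digamma (x : ℝ) : ℝ :=
  deriv (fun t : ℝ => Real.log (Real.Gamma t)) x

/-- The covariance matrix
`(α ψ'(α) - 1)⁻¹ • [[α, β], [β, β² ψ'(α)]]`. -/
def covShapeRate (α β : ℝ) : Matrix (Fin 2) (Fin 2) ℝ :=
  (α * deriv digamma α - 1)⁻¹ • !![α, β; β, β ^ 2 * deriv digamma α]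

/-- The scaling matrix `√n · diag (1, 1, √(ln n), 1, 1)`. -/
def scaling (n : ℕ) : Matrix (Fin 5) (Fin 5) ℝ :=
  Real.sqrt n • Matrix.diagonal ![1, 1, Real.sqrt (Real.log n), 1, 1]

/-- The joint law of the four independent blocks `((W_α, W_β), W_δ, W_μ, W_υ)` with
`(W_α, W_β) ∼ N₂(0, Σ_{1,β})`, `W_δ ∼ N(0, σ² / β)`, `W_μ ∼ N(0, σ² β)`, `W_υ ∼ N(0, 2 σ⁴)`. -/
abbrev limitBlocks (β σ : ℝ) : Measure (EuclideanSpace ℝ (Fin 2) × ℝ × ℝ × ℝ) :=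
  (multivariateGaussian 0 (covShapeRate 1 β)).prod
    ((gaussianReal 0 (σ ^ 2 / β).toNNReal).prod
      ((gaussianReal 0 (σ ^ 2 * β).toNNReal).prod (gaussianReal 0 (2 * σ ^ 4).toNNReal)))

/-- The vector `W = (W_α, W_β, W_δ, W_μ, W_υ)` assembled from its four blocks. -/
def assemble (w : EuclideanSpace ℝ (Fin 2) × ℝ × ℝ × ℝ) : Fin 5 → ℝ :=
  ![w.1 0, w.1 1, w.2.1, w.2.2.1, w.2.2.2]

end

end BGGL

namespace BGGL

open Topology Real

/-! ### Exponential moments of the gamma distribution and the digamma function -/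

/-! The log-likelihood splits into a gamma part in `(α, β)` and a normal part in `(δ, μ, υ)`, so the
likelihood equations can be almost solved in closed form. The shape solves `log α - ψ(α) = log (mean
X) - mean (log X)`, the rate is shape over sample mean, `(δ, μ)` is least squares with weights `1 /
X`, and `υ` is the mean weighted squared residual. Because `ψ'(α) > 1 / α` and the normal equations
are nondegenerate, this root is the only maximizer (`isMLE_and_unique`). With probability tending to
one, any estimator therefore equals `likelihoodRoot`, a function of two statistics: the sum `J` of
the influence functions and `R = (n log n)⁻¹ ∑ 1 / X_i`.

The unusual rate for `δ` comes from `α = 1`, where `1 / X` has a logarithmically divergent mean. The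
expansion `E (1 - exp (-l / X)) = β l log (1 / l) + O(l)`
(`abs_integral_one_sub_exp_neg_div_sub_le`) is used twice. It gives the limit of the Laplace
transform of `R`, hence `R → β` in probability. Conditionally on `X`, the characteristic function of
`Z / √X` at `b` is `exp (-(b² / 2) / X)`, so the same expansion gives a Gaussian limit for `∑ Z_i /
√X_i` under the norming `√(n log n)`.

The joint limit of `J` is proved by characteristic functions. The heavy-tailed summand decouples
from the square integrable ones because their product is integrable and its norming is faster
(`tendsto_mul_integral_cexp_add_sub_one`). The other blocks are independent because the covariances
vanish by the moments of `Z`. Finally, the delta method for the gamma block and Cramer's rule for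
the regression block show that the normalized error of `likelihoodRoot` is `J + o_P(1)`, and
Slutsky's theorem concludes. -/

lemma ae_gammaMeasure_pos (α β : ℝ) : ∀ᵐ x ∂gammaMeasure α β, 0 < x := by
  have h0 : ∀ᵐ x : ℝ ∂volume, x ≠ 0 := by simp [ae_iff]
  rw [gammaMeasure, ae_withDensity_iff (by unfold gammaPDF; fun_prop)]
  filter_upwards [h0] with x hx hne
  rcases lt_or_gt_of_ne hx with h | h
  · exact absurd (gammaPDF_of_neg h) hne
  · exact h

/-- Exponential tilting: multiplying a gamma density by `x ^ p * exp (q * x)` gives a multiple of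
the gamma density with shape `α + p` and rate `β - q`. -/
lemma lintegral_exp_log_gammaMeasure {α β p q : ℝ} (hα : 0 < α) (hβ : 0 < β) (hp : 0 < α + p)
    (hq : 0 < β - q) :
    ∫⁻ x, ENNReal.ofReal (exp (p * log x + q * x)) ∂gammaMeasure α β =
      ENNReal.ofReal (β ^ α / Gamma α * (Gamma (α + p) / (β - q) ^ (α + p))) := by
  have hG := Gamma_pos_of_pos hα
  have hG' := Gamma_pos_of_pos hp
  rw [gammaMeasure, lintegral_withDensity_eq_lintegral_mul _ (by unfold gammaPDF; fun_prop)
    (by fun_prop)]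
  have h0 : ∀ᵐ x : ℝ ∂volume, x ≠ 0 := by simp [ae_iff]
  set C := β ^ α / Gamma α * (Gamma (α + p) / (β - q) ^ (α + p)) with hC
  have hCpos : 0 ≤ C := by positivity
  calc _ = ∫⁻ x, ENNReal.ofReal C * gammaPDF (α + p) (β - q) x := by
        refine lintegral_congr_ae ?_
        filter_upwards [h0] with x hx
        rcases lt_or_gt_of_ne hx with h | h
        · simp [gammaPDF_of_neg h]
        · simp only [Pi.mul_apply]
          rw [gammaPDF_of_nonneg h.le, gammaPDF_of_nonneg h.le,
            ← ENNReal.ofReal_mul (by positivity), ← ENNReal.ofReal_mul hCpos]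
          congr 1
          have e1 : x ^ (α + p - 1) = x ^ (α - 1) * exp (p * log x) := by
            rw [show α + p - 1 = (α - 1) + p by ring, rpow_add h, rpow_def_of_pos h p,
              mul_comm (log x)]
          have e2 : exp (-((β - q) * x)) = exp (-(β * x)) * exp (q * x) := by
            rw [← exp_add]; ring_nf
          rw [e1, e2, exp_add, hC]
          have : (β - q) ^ (α + p) ≠ 0 := by positivity
          field_simp
    _ = _ := by
        rw [lintegral_const_mul _ (by unfold gammaPDF; fun_prop), lintegral_gammaPDF_eq_one hp hq,
          mul_one]

lemma integrable_exp_log_gammaMeasure {α β p q : ℝ} (hα : 0 < α) (hβ : 0 < β) (hp : 0 < α + p)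
    (hq : 0 < β - q) :
    Integrable (fun x => exp (p * log x + q * x)) (gammaMeasure α β) := by
  refine ⟨by fun_prop, ?_⟩
  rw [hasFiniteIntegral_iff_ofReal (ae_of_all _ fun x => (exp_pos _).le),
    lintegral_exp_log_gammaMeasure hα hβ hp hq]
  exact ENNReal.ofReal_lt_top

lemma integral_exp_log_gammaMeasure {α β p q : ℝ} (hα : 0 < α) (hβ : 0 < β) (hp : 0 < α + p)
    (hq : 0 < β - q) :
    ∫ x, exp (p * log x + q * x) ∂gammaMeasure α β =
      β ^ α / Gamma α * (Gamma (α + p) / (β - q) ^ (α + p)) := by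
  have hG := Gamma_pos_of_pos hα
  have hG' := Gamma_pos_of_pos hp
  rw [integral_eq_lintegral_of_nonneg_ae (ae_of_all _ fun x => (exp_pos _).le) (by fun_prop),
    lintegral_exp_log_gammaMeasure hα hβ hp hq, ENNReal.toReal_ofReal (by positivity)]

lemma eventually_pos_add_mul {α : ℝ} (hα : 0 < α) (a : ℝ) : ∀ᶠ t : ℝ in 𝓝 0, 0 < α + t * a := by
  have : Tendsto (fun t : ℝ => α + t * a) (𝓝 0) (𝓝 (α + 0 * a)) :=
    Continuous.tendsto (by fun_prop) 0
  exact this.eventually_const_lt (by simpa using hα)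

lemma zero_mem_interior_integrableExpSet_gammaMeasure {α β : ℝ} (hα : 0 < α) (hβ : 0 < β)
    (a b : ℝ) :
    0 ∈ interior (integrableExpSet (fun x => a * log x + b * x) (gammaMeasure α β)) := by
  rw [mem_interior_iff_mem_nhds]
  filter_upwards [eventually_pos_add_mul hα a, eventually_pos_add_mul hβ (-b)] with t h1 h2
  have := integrable_exp_log_gammaMeasure (p := t * a) (q := t * b) hα hβ h1 (by linarith)
  refine this.congr (ae_of_all _ fun x => ?_)
  simp only; ring_nf

/-- The cumulant generating function of `(log X, X)` along the direction `(a, b)`; its first two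
derivatives at `0` yield the means and covariances of both statistics. -/
lemma cgf_gammaMeasure {α β : ℝ} (hα : 0 < α) (hβ : 0 < β) (a b : ℝ) :
    cgf (fun x => a * log x + b * x) (gammaMeasure α β) =ᶠ[𝓝 0] fun t =>
      log (Gamma (α + t * a)) - (α + t * a) * log (β + t * (-b)) +
        log (β ^ α / Gamma α) := by
  filter_upwards [eventually_pos_add_mul hα a, eventually_pos_add_mul hβ (-b)] with t h1 h2
  have := integral_exp_log_gammaMeasure (p := t * a) (q := t * b) hα hβ h1 (by linarith)
  have hG := Gamma_pos_of_pos hα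
  have hG' := Gamma_pos_of_pos h1
  rw [cgf, mgf]
  have e : ∀ x, t * (a * log x + b * x) = t * a * log x + t * b * x := fun x => by ring
  simp only [e]
  rw [this, show β - t * b = β + t * (-b) by ring, log_mul (by positivity) (by positivity),
    log_div hG'.ne' (rpow_pos_of_pos h2 _).ne', log_rpow h2]
  ring

/-- Up to a constant, `t ↦ log Γ(α + t)` is the cumulant generating function of `log X` at rate one,
and such functions are analytic inside their domain. -/
lemma analyticAt_log_Gamma {α : ℝ} (hα : 0 < α) :
    AnalyticAt ℝ (fun t : ℝ => log (Gamma t)) α := by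
  have h1 := analyticAt_cgf (zero_mem_interior_integrableExpSet_gammaMeasure hα one_pos 1 0)
  have h2 := h1.congr (cgf_gammaMeasure hα one_pos 1 0)
  have h3 : AnalyticAt ℝ (fun t : ℝ => log (Gamma (α + t))) 0 := by
    have := h2.sub (analyticAt_const (v := log (1 ^ α / Gamma α)))
    refine this.congr (Eventually.of_forall fun t => ?_)
    simp
  have h4 : AnalyticAt ℝ (fun t : ℝ => t - α) α := by fun_prop
  have h5 := AnalyticAt.fun_comp (g := fun t : ℝ => log (Gamma (α + t)))
    (f := fun t : ℝ => t - α) (by simpa using h3) h4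
  simpa [Function.comp_def] using h5

lemma analyticAt_digamma {α : ℝ} (hα : 0 < α) : AnalyticAt ℝ digamma α :=
  (analyticAt_log_Gamma hα).deriv

lemma hasDerivAt_log_Gamma {α : ℝ} (hα : 0 < α) :
    HasDerivAt (fun t : ℝ => log (Gamma t)) (digamma α) α :=
  (analyticAt_log_Gamma hα).differentiableAt.hasDerivAt

lemma hasDerivAt_digamma {α : ℝ} (hα : 0 < α) :
    HasDerivAt digamma (deriv digamma α) α :=
  (analyticAt_digamma hα).differentiableAt.hasDerivAt

lemma hasDerivAt_add_mul (α a t : ℝ) : HasDerivAt (fun t : ℝ => α + t * a) a t := by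
  simpa using ((hasDerivAt_id t).mul_const a).const_add α

lemma deriv_cgf_gammaMeasure {α β : ℝ} (hα : 0 < α) (hβ : 0 < β) (a b : ℝ) :
    deriv (cgf (fun x => a * log x + b * x) (gammaMeasure α β)) =ᶠ[𝓝 0] fun t =>
      a * digamma (α + t * a) - a * log (β + t * (-b)) + b * ((α + t * a) / (β + t * (-b))) := by
  filter_upwards [(cgf_gammaMeasure hα hβ a b).eventuallyEq_nhds, eventually_pos_add_mul hα a,
    eventually_pos_add_mul hβ (-b)] with t h0 h1 h2
  rw [h0.deriv_eq]
  have d1 := (hasDerivAt_log_Gamma h1).comp t (hasDerivAt_add_mul α a t)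
  have d2 := ((hasDerivAt_add_mul β (-b) t).log h2.ne')
  have d3 := (d1.sub ((hasDerivAt_add_mul α a t).mul d2)).add_const (log (β ^ α / Gamma α))
  refine HasDerivAt.deriv (d3.congr_deriv ?_)
  field_simp
  ring

lemma integrable_gammaMeasure_log {α β : ℝ} (hα : 0 < α) (hβ : 0 < β) (a b : ℝ) :
    MemLp (fun x => a * log x + b * x) 2 (gammaMeasure α β) := by
  simpa using memLp_of_mem_interior_integrableExpSet
    (zero_mem_interior_integrableExpSet_gammaMeasure hα hβ a b) 2

lemma integral_gammaMeasure_log {α β : ℝ} (hα : 0 < α) (hβ : 0 < β) (a b : ℝ) :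
    ∫ x, (a * log x + b * x) ∂gammaMeasure α β = a * (digamma α - log β) + b * (α / β) := by
  have := isProbabilityMeasure_gammaMeasure hα hβ
  have h := deriv_cgf_zero (zero_mem_interior_integrableExpSet_gammaMeasure hα hβ a b)
  rw [(deriv_cgf_gammaMeasure hα hβ a b).self_of_nhds] at h
  simp only [zero_mul, add_zero, probReal_univ, div_one] at h
  rw [← h]; ring

lemma integral_sq_gammaMeasure_log {α β : ℝ} (hα : 0 < α) (hβ : 0 < β) (a b : ℝ) :
    ∫ x, (a * log x + b * x - (a * (digamma α - log β) + b * (α / β))) ^ 2 ∂gammaMeasure α β =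
      a ^ 2 * deriv digamma α + 2 * a * b / β + b ^ 2 * α / β ^ 2 := by
  have := isProbabilityMeasure_gammaMeasure hα hβ
  have hm := zero_mem_interior_integrableExpSet_gammaMeasure hα hβ a b
  have h := iteratedDeriv_two_cgf_eq_integral hm
  rw [deriv_cgf_zero hm, integral_gammaMeasure_log hα hβ] at h
  simp only [probReal_univ, div_one, zero_mul, exp_zero, mul_one, mgf_zero] at h
  rw [← h, iteratedDeriv_succ, iteratedDeriv_one, (deriv_cgf_gammaMeasure hα hβ a b).deriv_eq]
  have h1 : 0 < α + 0 * a := by simpa using hα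
  have h2 : 0 < β + 0 * (-b) := by simpa using hβ
  have d1 := (hasDerivAt_digamma h1).comp 0 (hasDerivAt_add_mul α a 0)
  have d2 := ((hasDerivAt_add_mul β (-b) 0).log h2.ne')
  have d3 := (hasDerivAt_add_mul α a 0).div (hasDerivAt_add_mul β (-b) 0) h2.ne'
  have d4 := ((d1.const_mul a).sub (d2.const_mul a)).add (d3.const_mul b)
  refine HasDerivAt.deriv (d4.congr_deriv ?_)
  simp only [zero_mul, add_zero]
  field_simp
  ring

/-- The function `α ↦ ln α - ψ(α)` is strictly decreasing because `ψ'(α) > 1 / α`, which expresses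
that `ln X - X / α` has positive variance when `X` is gamma distributed with shape `α`. -/
lemma inv_lt_deriv_digamma {α : ℝ} (hα : 0 < α) : α⁻¹ < deriv digamma α := by
  have := isProbabilityMeasure_gammaMeasure hα one_pos
  have h := integral_sq_gammaMeasure_log hα one_pos 1 (-α⁻¹)
  set m := 1 * (digamma α - log 1) + -α⁻¹ * (α / 1)
  have e : (1 : ℝ) ^ 2 * deriv digamma α + 2 * 1 * -α⁻¹ / 1 + (-α⁻¹) ^ 2 * α / 1 ^ 2 =
      deriv digamma α - α⁻¹ := by field_simp; ring
  rw [e] at h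
  have hi : Integrable (fun x => (1 * log x + -α⁻¹ * x - m) ^ 2) (gammaMeasure α 1) :=
    ((integrable_gammaMeasure_log hα one_pos 1 (-α⁻¹)).sub (memLp_const m)).integrable_sq
  have hnn : 0 ≤ deriv digamma α - α⁻¹ := by
    rw [← h]; exact integral_nonneg fun x => sq_nonneg _
  refine lt_of_le_of_ne (by linarith) fun heq => ?_
  rw [← heq, sub_self, integral_eq_zero_iff_of_nonneg (fun x => sq_nonneg _) hi] at h
  have h2 : (fun x => 1 * log x + -α⁻¹ * x - m) =ᵐ[volume.restrict (Set.Ioi 0)] fun _ => 0 := by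
    rw [Filter.EventuallyEq, gammaMeasure, ae_withDensity_iff (by unfold gammaPDF; fun_prop)] at h
    rw [Filter.EventuallyEq, ae_restrict_iff' measurableSet_Ioi]
    filter_upwards [h] with x hx hx0
    have := hx (by
      rw [gammaPDF]
      exact (ENNReal.ofReal_pos.2 (gammaPDFReal_pos hα one_pos hx0)).ne')
    exact pow_eq_zero_iff (two_ne_zero) |>.1 this
  have h3 := Measure.eqOn_open_of_ae_eq h2 isOpen_Ioi
    (by
      refine ContinuousOn.sub (ContinuousOn.add ?_ (by fun_prop)) (by fun_prop)
      exact continuousOn_const.mul (continuousOn_log.mono fun x hx => (Set.mem_Ioi.1 hx).ne'))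
    continuousOn_const
  -- Zero variance would make `log x - x / α` constant on the half-line. The values at `1, 2, 4`
  -- contradict this: `log` is in arithmetic progression there, the linear term is not.
  have k1 := h3 (x := 1) (by simp)
  have k2 := h3 (x := 2) (by simp)
  have k4 := h3 (x := 4) (by simp)
  have l4 : log 4 = 2 * log 2 := by
    rw [show (4 : ℝ) = 2 ^ 2 by norm_num, log_pow]; norm_num
  simp only [l4, log_one] at k1 k2 k4
  have : α⁻¹ = 0 := by linarith
  exact (inv_pos.2 hα).ne' this

/-! ### Moments of the standard normal distribution -/

lemma integral_pow_gaussianReal_zero_one :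
    ∫ z, z ∂gaussianReal 0 1 = 0 ∧ ∫ z, z ^ 2 ∂gaussianReal 0 1 = 1 ∧
      ∫ z, z ^ 3 ∂gaussianReal 0 1 = 0 ∧ ∫ z, z ^ 4 ∂gaussianReal 0 1 = 3 := by
  have hm : mgf id (gaussianReal 0 1) = fun t => exp (t ^ 2 / 2) := by
    rw [mgf_id_gaussianReal]; simp
  have h0 : (0 : ℝ) ∈ interior (integrableExpSet id (gaussianReal 0 1)) := by
    rw [integrableExpSet_id_gaussianReal]; simp
  have e (t : ℝ) : HasDerivAt (fun t : ℝ => exp (t ^ 2 / 2)) (exp (t ^ 2 / 2) * t) t := by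
    have := ((hasDerivAt_pow 2 t).div_const 2).exp
    refine this.congr_deriv ?_
    ring
  have d1 : deriv (fun t : ℝ => exp (t ^ 2 / 2)) = fun t => t * exp (t ^ 2 / 2) := by
    ext t; rw [(e t).deriv]; ring
  have d2 : deriv (fun t : ℝ => t * exp (t ^ 2 / 2)) = fun t => (t ^ 2 + 1) * exp (t ^ 2 / 2) := by
    ext t
    refine HasDerivAt.deriv (((hasDerivAt_id t).mul (e t)).congr_deriv ?_)
    simp; ring
  have d3 : deriv (fun t : ℝ => (t ^ 2 + 1) * exp (t ^ 2 / 2)) =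
      fun t => (t ^ 3 + 3 * t) * exp (t ^ 2 / 2) := by
    ext t
    refine HasDerivAt.deriv ((((hasDerivAt_pow 2 t).add_const 1).mul (e t)).congr_deriv ?_)
    simp; ring
  have d4 : deriv (fun t : ℝ => (t ^ 3 + 3 * t) * exp (t ^ 2 / 2)) =
      fun t => (t ^ 4 + 6 * t ^ 2 + 3) * exp (t ^ 2 / 2) := by
    ext t
    refine HasDerivAt.deriv ((((hasDerivAt_pow 3 t).add
      ((hasDerivAt_id t).const_mul 3)).mul (e t)).congr_deriv ?_)
    simp; ring
  have i (n : ℕ) := iteratedDeriv_mgf_zero h0 n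
  rw [hm] at i
  refine ⟨?_, ?_, ?_, ?_⟩
  · simp
  · have := i 2
    simp only [iteratedDeriv_succ, iteratedDeriv_zero, d1, d2] at this
    simpa using this.symm
  · have := i 3
    simp only [iteratedDeriv_succ, iteratedDeriv_zero, d1, d2, d3] at this
    simpa using this.symm
  · have := i 4
    simp only [iteratedDeriv_succ, iteratedDeriv_zero, d1, d2, d3, d4] at this
    simpa using this.symm

lemma integrable_pow_gaussianReal (n : ℕ) : Integrable (fun z : ℝ => z ^ n) (gaussianReal 0 1) := by
  have h0 : (0 : ℝ) ∈ interior (integrableExpSet id (gaussianReal 0 1)) := by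
    rw [integrableExpSet_id_gaussianReal]; simp
  simpa using integrable_pow_of_mem_interior_integrableExpSet h0 n

/-! ### The Laplace transform of the reciprocal of an exponential random variable -/

lemma integral_gammaMeasure_one {β : ℝ} (hβ : 0 < β) (f : ℝ → ℝ) :
    ∫ x, f x ∂gammaMeasure 1 β =
      ∫ x in Set.Ioi 0, β * exp (-(β * x)) * f x := by
  rw [gammaMeasure, integral_withDensity_eq_integral_toReal_smul
    (f := gammaPDF 1 β) (by unfold gammaPDF; fun_prop)
    (ae_of_all _ fun x => ENNReal.ofReal_lt_top), ← integral_Ici_eq_integral_Ioi, ← integral_indicator measurableSet_Ici]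
  refine integral_congr_ae (ae_of_all _ fun x => ?_)
  by_cases hx : 0 ≤ x
  · simp only [Set.indicator_of_mem (Set.mem_Ici.2 hx), gammaPDF_of_nonneg hx, smul_eq_mul]
    rw [ENNReal.toReal_ofReal (by simp; positivity)]
    simp
  · simp [Set.indicator, hx, gammaPDF_of_neg (not_le.1 hx)]

/-- The density is about `β` near zero, so the range `(l, 1]`, where the integrand is close to `β *
l / x`, produces the logarithm. The three terms of the constant collect `β * l` from `(0, l]`, `(β ^
2 + β) * l` from `(l, 1]` and `l` from `(1, ∞)`. -/
lemma abs_integral_one_sub_exp_neg_div_sub_le {β l : ℝ} (hβ : 0 < β) (hl : 0 < l) (hl1 : l < 1) :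
    |∫ x, (1 - exp (-(l / x))) ∂gammaMeasure 1 β - β * l * log l⁻¹| ≤
      (1 + 2 * β + β ^ 2) * l := by
  rw [integral_gammaMeasure_one hβ]
  set g : ℝ → ℝ := fun x => β * exp (-(β * x)) * (1 - exp (-(l / x))) with hg
  have hgm : Measurable g := by fun_prop
  have hE (x : ℝ) (hx : 0 < x) : 0 ≤ 1 - exp (-(l / x)) ∧ 1 - exp (-(l / x)) ≤ 1 ∧
      1 - exp (-(l / x)) ≤ l / x := by
    have h1 := add_one_le_exp (-(l / x))
    have h2 : exp (-(l / x)) ≤ 1 := exp_le_one_iff.2 (by simp; positivity)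
    exact ⟨by linarith, by linarith [exp_pos (-(l / x))], by linarith⟩
  have hexp : IntegrableOn (fun x => β * exp (-(β * x))) (Set.Ioi 0) := by
    have := (exp_neg_integrableOn_Ioi 0 hβ).const_mul β
    simpa [neg_mul, IntegrableOn] using this
  have hgi : IntegrableOn g (Set.Ioi 0) := by
    refine hexp.mono' hgm.aestronglyMeasurable.restrict ?_
    rw [ae_restrict_iff' measurableSet_Ioi]
    refine ae_of_all _ fun x hx => ?_
    obtain ⟨h1, h2, -⟩ := hE x hx
    rw [hg, norm_mul, norm_of_nonneg (by positivity), norm_of_nonneg h1]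
    exact mul_le_of_le_one_right (by positivity) h2
  have hs1 : Set.Ioi (0 : ℝ) = (Set.Ioc 0 l ∪ Set.Ioc l 1) ∪ Set.Ioi 1 := by
    rw [Set.Ioc_union_Ioc_eq_Ioc hl.le hl1.le, Set.Ioc_union_Ioi_eq_Ioi zero_le_one]
  have i1 : IntegrableOn g (Set.Ioc 0 l) := hgi.mono_set Set.Ioc_subset_Ioi_self
  have i2 : IntegrableOn g (Set.Ioc l 1) :=
    hgi.mono_set (Set.Ioc_subset_Ioi_self.trans (Set.Ioi_subset_Ioi hl.le))
  have i3 : IntegrableOn g (Set.Ioi 1) := hgi.mono_set (Set.Ioi_subset_Ioi zero_le_one)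
  have hsplit : ∫ x in Set.Ioi 0, g x =
      (∫ x in Set.Ioc 0 l, g x) + (∫ x in Set.Ioc l 1, g x) + ∫ x in Set.Ioi 1, g x := by
    rw [hs1, setIntegral_union _ measurableSet_Ioi (i1.union i2) i3,
      setIntegral_union _ measurableSet_Ioc i1 i2]
    · exact Set.Ioc_disjoint_Ioc_of_le le_rfl
    · rw [Set.Ioc_union_Ioc_eq_Ioc hl.le hl1.le]
      exact Set.disjoint_left.2 fun x hx hx' => not_lt.2 hx.2 hx'
  have b1 : |∫ x in Set.Ioc 0 l, g x| ≤ β * l := by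
    have := norm_setIntegral_le_of_norm_le_const (μ := volume) (s := Set.Ioc 0 l) (f := g) (C := β)
      (by simp) (fun x hx => by
        obtain ⟨h1, h2, -⟩ := hE x hx.1
        have h3 : exp (-(β * x)) ≤ 1 :=
          exp_le_one_iff.2 (by simp; exact (mul_pos hβ hx.1).le)
        rw [hg, norm_mul, norm_of_nonneg (by positivity), norm_of_nonneg h1, mul_assoc]
        exact mul_le_of_le_one_right hβ.le (mul_le_one₀ h3 h1 h2))
    simpa [hl.le] using this
  have b3 : |∫ x in Set.Ioi 1, g x| ≤ l := by
    have hi : IntegrableOn (fun x => β * exp (-(β * x)) * l) (Set.Ioi 0) := hexp.mul_const l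
    have hle : |∫ x in Set.Ioi 1, g x| ≤ ∫ x in Set.Ioi 1, β * exp (-(β * x)) * l := by
      rw [← Real.norm_eq_abs]
      refine norm_integral_le_of_norm_le (hi.mono_set (Set.Ioi_subset_Ioi zero_le_one)) ?_
      rw [ae_restrict_iff' measurableSet_Ioi]
      refine ae_of_all _ fun x hx => ?_
      have hx' : (1 : ℝ) < x := hx
      obtain ⟨h1, -, h2⟩ := hE x (by linarith)
      rw [hg, norm_mul, norm_of_nonneg (by positivity), norm_of_nonneg h1]
      have : l / x ≤ l := div_le_self hl.le hx'.le
      gcongr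
      linarith
    have hle2 : ∫ x in Set.Ioi 1, β * exp (-(β * x)) * l ≤
        ∫ x in Set.Ioi 0, β * exp (-(β * x)) * l := by
      refine setIntegral_mono_set hi (ae_of_all _ fun x => by simp; positivity)
        (Set.Ioi_subset_Ioi zero_le_one).eventuallyLE
    have h1 : ∫ x in Set.Ioi 0, β * exp (-(β * x)) * l = l := by
      have := integral_exp_mul_Ioi (a := -β) (by linarith) 0
      rw [integral_mul_const, integral_const_mul]
      simp only [neg_mul] at this
      rw [this]
      simp [hβ.ne']
    linarith
  have hl0 : (0 : ℝ) ∉ Set.uIcc l 1 := by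
    rw [Set.uIcc_of_le hl1.le]; exact fun h => not_le.2 hl h.1
  have j2 : ∫ x in Set.Ioc l 1, β * l / x = β * l * log l⁻¹ := by
    rw [← intervalIntegral.integral_of_le hl1.le]
    simp only [div_eq_mul_inv]
    rw [intervalIntegral.integral_const_mul, integral_inv hl0, one_div]
  have k2 : IntegrableOn (fun x => β * l / x) (Set.Ioc l 1) := by
    refine (ContinuousOn.integrableOn_Icc ?_).mono_set Set.Ioc_subset_Icc_self
    exact continuousOn_const.div continuousOn_id fun x hx => (lt_of_lt_of_le hl hx.1).ne'
  have k3 : IntegrableOn (fun x : ℝ => β ^ 2 * l + β * l ^ 2 * x ^ (-2 : ℤ)) (Set.Ioc l 1) := by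
    refine (ContinuousOn.integrableOn_Icc ?_).mono_set Set.Ioc_subset_Icc_self
    refine continuousOn_const.add (continuousOn_const.mul ?_)
    exact continuousOn_id.zpow₀ (-2) fun x hx => Or.inl (lt_of_lt_of_le hl hx.1).ne'
  have b2 : |(∫ x in Set.Ioc l 1, g x) - β * l * log l⁻¹| ≤ (β ^ 2 + β) * l := by
    rw [← j2, ← integral_sub i2 k2]
    have hle : |∫ x in Set.Ioc l 1, (g x - β * l / x)| ≤
        ∫ x in Set.Ioc l 1, (β ^ 2 * l + β * l ^ 2 * x ^ (-2 : ℤ)) := by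
      rw [← Real.norm_eq_abs]
      refine norm_integral_le_of_norm_le k3 ?_
      rw [ae_restrict_iff' measurableSet_Ioc]
      refine ae_of_all _ fun x hx => ?_
      have hx0 : 0 < x := hl.trans hx.1
      have hu : |-(l / x)| ≤ 1 := by
        rw [abs_neg, abs_of_pos (by positivity), div_le_one hx0]
        exact hx.1.le
      have hq := abs_exp_sub_one_sub_id_le hu
      have hq1 := (abs_le.1 hq).2
      have hq0 := add_one_le_exp (-(l / x))
      have hb1 := add_one_le_exp (-(β * x))
      have hb0 : exp (-(β * x)) ≤ 1 := exp_le_one_iff.2 (by simp; positivity)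
      -- Two errors of the same sign: replacing `exp (-(β * x))` by `1` costs at most `β ^ 2 * l`,
      -- and replacing `1 - exp (-(l / x))` by `l / x` costs at most `β * l ^ 2 / x ^ 2`.
      have heq : g x - β * l / x = -(β * (l / x) * (1 - exp (-(β * x))) +
          β * (exp (-(β * x)) * (exp (-(l / x)) - 1 - -(l / x)))) := by
        rw [hg]; ring
      rw [heq, norm_neg, norm_of_nonneg (add_nonneg
        (mul_nonneg (by positivity) (by linarith))
        (mul_nonneg hβ.le (mul_nonneg (exp_pos _).le (by linarith))))]
      have t1 : β * (l / x) * (1 - exp (-(β * x))) ≤ β * (l / x) * (β * x) := by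
        gcongr; linarith
      have t2 : exp (-(β * x)) * (exp (-(l / x)) - 1 - -(l / x)) ≤ 1 * (-(l / x)) ^ 2 :=
        mul_le_mul hb0 hq1 (by linarith) zero_le_one
      have t3 := mul_le_mul_of_nonneg_left t2 hβ.le
      have e1 : β * (l / x) * (β * x) = β ^ 2 * l := by field_simp
      have e2 : β * (1 * (-(l / x)) ^ 2) = β * l ^ 2 * x ^ (-2 : ℤ) := by
        rw [_root_.zpow_neg]; field_simp
      linarith
    refine hle.trans ?_
    rw [← intervalIntegral.integral_of_le hl1.le, intervalIntegral.integral_add,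
      intervalIntegral.integral_const_mul (β * l ^ 2), integral_zpow (Or.inr ⟨by norm_num, hl0⟩)]
    · simp only [intervalIntegral.integral_const, smul_eq_mul]
      have e : ((1 : ℝ) ^ (-2 + 1 : ℤ) - l ^ (-2 + 1 : ℤ)) / ((-2 : ℤ) + 1) = l⁻¹ - 1 := by
        norm_num
        ring
      rw [e]
      have : β * l ^ 2 * (l⁻¹ - 1) = β * l - β * l ^ 2 := by field_simp
      rw [this]
      nlinarith [sq_nonneg (β * l), mul_nonneg hβ.le (sq_nonneg l)]
    · simp
    · rw [intervalIntegrable_iff_integrableOn_Ioc_of_le hl1.le]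
      refine (ContinuousOn.integrableOn_Icc ?_).mono_set Set.Ioc_subset_Icc_self
      refine (continuousOn_const.mul ?_)
      exact continuousOn_id.zpow₀ (-2) fun x hx => Or.inl (lt_of_lt_of_le hl hx.1).ne'
  rw [hsplit]
  have := abs_add_three (∫ x in Set.Ioc 0 l, g x)
    ((∫ x in Set.Ioc l 1, g x) - β * l * log l⁻¹) (∫ x in Set.Ioi 1, g x)
  calc _ = |(∫ x in Set.Ioc 0 l, g x) + ((∫ x in Set.Ioc l 1, g x) - β * l * log l⁻¹) +
        ∫ x in Set.Ioi 1, g x| := by ring_nf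
    _ ≤ _ := by nlinarith

/-- For `l = κ / (n log n)` one has `log l⁻¹ = log n + log (log n) - log κ`, whose leading term
cancels the logarithm in the norming; the `O(l)` error contributes `O(1 / log n)`. -/
lemma tendsto_mul_integral_one_sub_exp {β κ : ℝ} (hβ : 0 < β) (hκ : 0 < κ) :
    Tendsto (fun n : ℕ => n * ∫ x, (1 - exp (-(κ / (n * log n) / x))) ∂gammaMeasure 1 β) atTop
      (𝓝 (β * κ)) := by
  have hn : Tendsto (fun n : ℕ => (n : ℝ)) atTop atTop := tendsto_natCast_atTop_atTop
  have hlog : Tendsto (fun n : ℕ => log n) atTop atTop := tendsto_log_atTop.comp hn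
  have hinv : Tendsto (fun n : ℕ => (log n)⁻¹) atTop (𝓝 0) := tendsto_inv_atTop_zero.comp hlog
  have hprod : Tendsto (fun n : ℕ => (n : ℝ) * log n) atTop atTop := hn.atTop_mul_atTop₀ hlog
  have hll : Tendsto (fun n : ℕ => log (log n) / log n) atTop (𝓝 0) :=
    (isLittleO_log_id_atTop.tendsto_div_nhds_zero).comp hlog
  have hmain : Tendsto (fun n : ℕ => β * κ * (1 + log (log n) / log n - log κ * (log n)⁻¹)) atTop
      (𝓝 (β * κ)) := by
    have := (((tendsto_const_nhds (x := (1 : ℝ))).add hll).sub (hinv.const_mul (log κ))).const_mul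
      (β * κ)
    simpa using this
  have herr : Tendsto (fun n : ℕ => (1 + 2 * β + β ^ 2) * κ * (log n)⁻¹) atTop (𝓝 0) := by
    simpa using hinv.const_mul ((1 + 2 * β + β ^ 2) * κ)
  refine tendsto_of_tendsto_of_dist hmain ?_
  refine squeeze_zero' (Eventually.of_forall fun _ => dist_nonneg) ?_ herr
  have hlt : ∀ᶠ n : ℕ in atTop, κ / (n * log n) < 1 :=
    (tendsto_const_nhds.div_atTop hprod).eventually_lt_const one_pos
  filter_upwards [hlt, hlog.eventually_gt_atTop 0, hn.eventually_gt_atTop 0] with n h1 h2 h3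
  have hb := abs_integral_one_sub_exp_neg_div_sub_le hβ (by positivity) h1
  set F := ∫ x, (1 - exp (-(κ / (n * log n) / x))) ∂gammaMeasure 1 β
  rw [Real.dist_eq, abs_sub_comm]
  have e1 : log (κ / (n * log n))⁻¹ = log n + log (log n) - log κ := by
    rw [inv_div, log_div (by positivity) hκ.ne', log_mul h3.ne' h2.ne']
  have e2 : n * F - β * κ * (1 + log (log n) / log n - log κ * (log n)⁻¹) =
      n * (F - β * (κ / (n * log n)) * log (κ / (n * log n))⁻¹) := by
    rw [e1]; field_simp
  rw [e2, abs_mul, abs_of_pos h3]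
  calc _ ≤ n * ((1 + 2 * β + β ^ 2) * (κ / (n * log n))) := by gcongr
    _ = _ := by field_simp

/-! ### Convergence in probability to a constant -/

lemma tendstoInMeasure_comp_continuousAt {Ω E F : Type*} [MeasurableSpace Ω] {P : Measure Ω}
    [PseudoMetricSpace E] [PseudoMetricSpace F] {f : ℕ → Ω → E} {c : E} {g : E → F}
    (hf : TendstoInMeasure P f atTop (fun _ => c)) (hg : ContinuousAt g c) :
    TendstoInMeasure P (fun n ω => g (f n ω)) atTop (fun _ => g c) := by
  rw [tendstoInMeasure_iff_dist] at hf ⊢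
  intro ε hε
  obtain ⟨δ, hδ, h⟩ := Metric.continuousAt_iff.1 hg ε hε
  refine tendsto_of_tendsto_of_tendsto_of_le_of_le tendsto_const_nhds (hf δ hδ)
    (fun _ => zero_le) fun n => measure_mono fun ω hω => ?_
  by_contra hlt
  exact absurd (h (not_le.1 hlt)) (not_lt.2 hω)

lemma tendsto_measure_notMem {Ω E : Type*} [MeasurableSpace Ω] {P : Measure Ω}
    [PseudoMetricSpace E] {f : ℕ → Ω → E} {c : E} {U : Set E}
    (hf : TendstoInMeasure P f atTop (fun _ => c)) (hU : U ∈ 𝓝 c) :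
    Tendsto (fun n => P {ω | f n ω ∉ U}) atTop (𝓝 0) := by
  rw [tendstoInMeasure_iff_dist] at hf
  obtain ⟨δ, hδ, h⟩ := Metric.mem_nhds_iff.1 hU
  refine tendsto_of_tendsto_of_tendsto_of_le_of_le tendsto_const_nhds (hf δ hδ)
    (fun _ => zero_le) fun n => measure_mono fun ω hω => ?_
  by_contra hlt
  exact hω (h (Metric.mem_ball.2 (not_le.1 hlt)))

lemma tendstoInMeasure_const_of_tendsto_integral_sq {Ω : Type*} [MeasurableSpace Ω]
    {P : Measure Ω} [IsFiniteMeasure P] {f : ℕ → Ω → ℝ} {c : ℝ}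
    (hi : ∀ n, Integrable (fun ω => (f n ω - c) ^ 2) P)
    (hf : Tendsto (fun n => ∫ ω, (f n ω - c) ^ 2 ∂P) atTop (𝓝 0)) :
    TendstoInMeasure P f atTop (fun _ => c) := by
  rw [tendstoInMeasure_iff_measureReal_dist]
  intro ε hε
  have h := hf.const_mul (ε ^ 2)⁻¹
  rw [mul_zero] at h
  refine squeeze_zero (fun _ => measureReal_nonneg) (fun n => ?_) h
  have := mul_meas_ge_le_integral_of_nonneg (ae_of_all _ fun ω => sq_nonneg (f n ω - c)) (hi n)
    (ε ^ 2)
  rw [← div_eq_inv_mul, le_div_iff₀' (by positivity)]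
  refine le_trans ?_ this
  refine mul_le_mul_of_nonneg_left (measureReal_mono fun ω hω => ?_) (sq_nonneg ε)
  have hω' : ε ≤ |f n ω - c| := hω
  change ε ^ 2 ≤ (f n ω - c) ^ 2
  rw [← sq_abs (f n ω - c)]
  gcongr

/-! ### Weak law for reciprocals of exponential random variables -/

/-- By independence the Laplace transform is an `n`-th power of `1 - c_n` with `n * c_n → β * κ`. -/
lemma tendsto_integral_exp_neg_sum_inv {Ω : Type*} [MeasurableSpace Ω] {P : Measure Ω}
    [IsProbabilityMeasure P] {β κ : ℝ} (hβ : 0 < β) (hκ : 0 < κ) {X : ℕ → Ω → ℝ}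
    (hX : iIndepFun X P) (hlaw : ∀ i, HasLaw (X i) (gammaMeasure 1 β) P) :
    Tendsto (fun n : ℕ => ∫ ω, exp (-(κ * (((n : ℝ) * log n)⁻¹ *
      ∑ i ∈ Finset.range n, (X i ω)⁻¹))) ∂P) atTop (𝓝 (exp (-(β * κ)))) := by
  have := isProbabilityMeasure_gammaMeasure one_pos hβ
  have h := Real.tendsto_one_add_pow_exp_of_tendsto
    (g := fun n : ℕ => -∫ x, (1 - exp (-(κ / (n * log n) / x))) ∂gammaMeasure 1 β)
    (t := -(β * κ)) (by simpa using (tendsto_mul_integral_one_sub_exp hβ hκ).neg)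
  refine h.congr fun n => ?_
  set l := κ / (n * log n) with hl
  have hlog : 0 ≤ log (n : ℝ) := log_natCast_nonneg n
  have hl0 : 0 ≤ l := by positivity
  have hind : iIndepFun (fun i ω => (X i ω)⁻¹) P := hX.comp (fun _ x => x⁻¹) (by fun_prop)
  have hm := hind.mgf_sum₀ (t := -l) (fun i => (hlaw i).aemeasurable.inv) (Finset.range n)
  have hmgf i : mgf (fun ω => (X i ω)⁻¹) P (-l) = ∫ x, exp (-(l / x)) ∂gammaMeasure 1 β := by
    rw [mgf, ← (hlaw i).integral_comp (f := fun x => exp (-(l / x))) (by fun_prop)]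
    simp [div_eq_mul_inv]
  simp only [hmgf, Finset.prod_const, Finset.card_range] at hm
  have hint : Integrable (fun x => exp (-(l / x))) (gammaMeasure 1 β) := by
    refine Integrable.of_bound (by fun_prop) 1 ?_
    filter_upwards [ae_gammaMeasure_pos 1 β] with x hx
    rw [norm_of_nonneg (exp_pos _).le, exp_le_one_iff]
    simp only [Left.neg_nonpos_iff]
    positivity
  rw [integral_sub (integrable_const _) hint]
  simp only [integral_const, probReal_univ, smul_eq_mul, mul_one, neg_sub, add_sub_cancel]
  rw [← hm, mgf]
  refine integral_congr_ae (ae_of_all _ fun ω => ?_)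
  simp only [Finset.sum_apply, hl]
  congr 1
  field_simp

/-- The law of large numbers is unavailable since `1 / X` has infinite mean. Instead `exp (-R)`
converges in `L²` to `exp (-β)`: expanding the square uses the Laplace transform only at `κ = 1` and
`κ = 2`, and the limits cancel. Applying `-log` recovers `R`. -/
lemma tendstoInMeasure_sum_inv {Ω : Type*} [MeasurableSpace Ω] {P : Measure Ω}
    [IsProbabilityMeasure P] {β : ℝ} (hβ : 0 < β) {X : ℕ → Ω → ℝ}
    (hX : iIndepFun X P) (hlaw : ∀ i, HasLaw (X i) (gammaMeasure 1 β) P) :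
    TendstoInMeasure P (fun (n : ℕ) ω => ((n : ℝ) * log n)⁻¹ * ∑ i ∈ Finset.range n, (X i ω)⁻¹)
      atTop (fun _ => β) := by
  set R : ℕ → Ω → ℝ := fun n ω => ((n : ℝ) * log n)⁻¹ * ∑ i ∈ Finset.range n, (X i ω)⁻¹ with hR
  have hRm n : AEMeasurable (R n) P :=
    (Finset.aemeasurable_fun_sum _ fun i _ => (hlaw i).aemeasurable.inv).const_mul _
  have hpos : ∀ᵐ ω ∂P, ∀ i, 0 < X i ω := by
    rw [ae_all_iff]
    exact fun i => ((hlaw i).ae_iff (by fun_prop)).2 (ae_gammaMeasure_pos 1 β)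
  have hRn n : ∀ᵐ ω ∂P, 0 ≤ R n ω := by
    filter_upwards [hpos] with ω hω
    have hlog : 0 ≤ log (n : ℝ) := log_natCast_nonneg n
    exact mul_nonneg (by positivity) (Finset.sum_nonneg fun i _ => (inv_pos.2 (hω i)).le)
  have hi (κ : ℝ) (hκ : 0 < κ) n : Integrable (fun ω => exp (-(κ * R n ω))) P := by
    refine Integrable.of_bound (by have := hRm n; fun_prop) 1 ?_
    filter_upwards [hRn n] with ω hω
    rw [norm_of_nonneg (exp_pos _).le, exp_le_one_iff]
    simp only [Left.neg_nonpos_iff]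
    positivity
  have hsq n ω : (exp (-(1 * R n ω)) - exp (-β)) ^ 2 =
      exp (-(2 * R n ω)) - 2 * exp (-β) * exp (-(1 * R n ω)) + exp (-β) ^ 2 := by
    have : exp (-(2 * R n ω)) = exp (-(1 * R n ω)) ^ 2 := by
      rw [← exp_nat_mul]; congr 1; push_cast; ring
    rw [this]; ring
  have hint n := (((hi 2 two_pos n).sub ((hi 1 one_pos n).const_mul (2 * exp (-β)))).add
    (integrable_const (exp (-β) ^ 2)))
  have h1 : TendstoInMeasure P (fun n ω => exp (-(1 * R n ω))) atTop (fun _ => exp (-β)) := by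
    refine tendstoInMeasure_const_of_tendsto_integral_sq (fun n => ?_) ?_
    · simp only [hsq]
      exact hint n
    · have t2 := tendsto_integral_exp_neg_sum_inv hβ two_pos hX hlaw
      have t1 := tendsto_integral_exp_neg_sum_inv hβ one_pos hX hlaw
      have t := (t2.sub (t1.const_mul (2 * exp (-β)))).add_const (exp (-β) ^ 2)
      have e : exp (-(β * 2)) - 2 * exp (-β) * exp (-(β * 1)) + exp (-β) ^ 2 = 0 := by
        rw [show -(β * 2) = -β + -β by ring, exp_add, mul_one]; ring
      rw [e] at t
      refine t.congr fun n => ?_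
      simp only [hsq]
      have i1 := (hi 1 one_pos n).const_mul (2 * exp (-β))
      have i2 : Integrable (fun ω => exp (-(2 * R n ω)) - 2 * exp (-β) * exp (-(1 * R n ω))) P :=
        (hi 2 two_pos n).sub i1
      rw [integral_add i2 (integrable_const _), integral_sub (hi 2 two_pos n) i1,
        integral_const_mul]
      simp [hR]
  have h2 := tendstoInMeasure_comp_continuousAt h1 (g := fun x => -log x)
    ((continuousAt_log (exp_pos _).ne').neg)
  simpa using h2

/-! ### Characteristic functions of the summands -/

lemma tendsto_inv_sqrt_natCast : Tendsto (fun n : ℕ => (√(n : ℝ))⁻¹) atTop (𝓝 0) :=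
  tendsto_inv_atTop_zero.comp (tendsto_sqrt_atTop.comp tendsto_natCast_atTop_atTop)

/-- Second-order Taylor expansion of the characteristic function at zero, read along `(√n)⁻¹`. -/
lemma tendsto_mul_integral_cexp_sub_one {E : Type*} [MeasurableSpace E] {ν : Measure E}
    [IsProbabilityMeasure ν] {T : E → ℝ} (hTm : Measurable T) (hT : MemLp T 2 ν)
    (hT0 : ∫ p, T p ∂ν = 0) :
    Tendsto (fun n : ℕ => (n : ℂ) * (∫ p, Complex.exp (Complex.I * ((√n)⁻¹ * T p : ℝ)) ∂ν - 1))
      atTop (𝓝 (-((∫ p, T p ^ 2 ∂ν : ℝ) / 2))) := by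
  have hmap : IsProbabilityMeasure (ν.map T) := Measure.isProbabilityMeasure_map hTm.aemeasurable
  have hid : MemLp id 2 (ν.map T) := (memLp_map_measure_iff (by fun_prop) hTm.aemeasurable).2 hT
  set V : ℝ := ∫ p, T p ^ 2 ∂ν with hV
  have htay : (fun t : ℝ => charFun (ν.map T) t - (1 - V * t ^ 2 / 2)) =o[𝓝 0]
      fun t => t ^ 2 := by
    have h := taylor_isLittleO_univ (x₀ := 0) (n := 2) (contDiff_charFun (n := 2) hid)
    simp_rw [taylorWithinEval_charFun_two_zero hTm.aemeasurable hid] at h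
    simpa [hT0, hV] using h
  have h1 := htay.comp_tendsto tendsto_inv_sqrt_natCast
  have h2 := h1.tendsto_inv_smul_nhds_zero
  have h3 := h2.const_add (-((V : ℂ) / 2))
  rw [add_zero] at h3
  refine h3.congr' ?_
  filter_upwards [eventually_gt_atTop 0] with n hn
  have hn' : (0 : ℝ) < n := by exact_mod_cast hn
  have hc : charFun (ν.map T) (√n)⁻¹ =
      ∫ p, Complex.exp (Complex.I * ((√n)⁻¹ * T p : ℝ)) ∂ν := by
    rw [charFun_apply_real, integral_map hTm.aemeasurable (by fun_prop)]
    refine integral_congr_ae (ae_of_all _ fun p => ?_)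
    simp only; congr 1; push_cast; ring
  simp only [Function.comp_apply]
  rw [hc, inv_pow, sq_sqrt hn'.le, inv_inv, Complex.real_smul]
  have e : (((√(n : ℝ))⁻¹ : ℝ) : ℂ) ^ 2 = (n : ℂ)⁻¹ := by
    rw [← Complex.ofReal_pow, inv_pow, sq_sqrt hn'.le]; simp
  have hne : (n : ℂ) ≠ 0 := by exact_mod_cast hn.ne'
  rw [e]
  push_cast
  field_simp
  ring

/-- Adding to a square integrable variable `T`, normalized by `√n`, a variable `S` normalized by
a faster sequence `b`: the cross term is negligible as soon as `T * S` is integrable. -/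
lemma tendsto_mul_integral_cexp_add_sub_one {E : Type*} [MeasurableSpace E] {ν : Measure E}
    [IsProbabilityMeasure ν] {T S : E → ℝ} (hTm : Measurable T) (hSm : Measurable S)
    (hT : MemLp T 2 ν) (hT0 : ∫ p, T p ∂ν = 0) (hTS : Integrable (fun p => T p * S p) ν)
    {b : ℕ → ℝ} (hb : Tendsto (fun n : ℕ => √n * |b n|) atTop (𝓝 0)) {w : ℂ}
    (hS : Tendsto (fun n : ℕ => (n : ℂ) * (∫ p, Complex.exp (Complex.I * (b n * S p : ℝ)) ∂ν - 1))
      atTop (𝓝 w)) :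
    Tendsto (fun n : ℕ => (n : ℂ) *
      (∫ p, Complex.exp (Complex.I * ((√n)⁻¹ * T p + b n * S p : ℝ)) ∂ν - 1))
      atTop (𝓝 (-((∫ p, T p ^ 2 ∂ν : ℝ) / 2) + w)) := by
  have hint (f : E → ℝ) (hf : Measurable f) :
      Integrable (fun p => Complex.exp (Complex.I * (f p : ℝ))) ν := by
    refine Integrable.of_bound (by fun_prop) 1 (ae_of_all _ fun p => ?_)
    rw [Complex.norm_exp_I_mul_ofReal]
  set C : ℕ → ℂ := fun n => ∫ p, (Complex.exp (Complex.I * ((√n)⁻¹ * T p : ℝ)) - 1) *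
    (Complex.exp (Complex.I * (b n * S p : ℝ)) - 1) ∂ν with hC
  -- By `|exp (i x) - 1| ≤ |x|` in both factors, the cross term is at most `n * (√n)⁻¹ * |b n| * E
  -- |T S|`, that is, `√n * |b n| * E |T S|`.
  have hcross : Tendsto (fun n : ℕ => (n : ℂ) * C n) atTop (𝓝 0) := by
    have hlim : Tendsto (fun n : ℕ => √n * |b n| * ∫ p, |T p * S p| ∂ν) atTop (𝓝 0) := by
      simpa using hb.mul_const _
    refine squeeze_zero_norm (fun n => ?_) hlim
    have hle : ‖C n‖ ≤ ∫ p, (√n)⁻¹ * |b n| * |T p * S p| ∂ν := by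
      refine norm_integral_le_of_norm_le (hTS.abs.const_mul _) (ae_of_all _ fun p => ?_)
      rw [norm_mul]
      have h1 := Real.norm_exp_I_mul_ofReal_sub_one_le (x := (√n)⁻¹ * T p)
      have h2 := Real.norm_exp_I_mul_ofReal_sub_one_le (x := b n * S p)
      calc _ ≤ ‖(√n)⁻¹ * T p‖ * ‖b n * S p‖ := by gcongr
        _ = _ := by
          rw [norm_mul, norm_mul, norm_of_nonneg (by positivity : 0 ≤ (√(n : ℝ))⁻¹)]
          simp only [Real.norm_eq_abs, abs_mul]; ring
    rw [integral_const_mul] at hle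
    rw [norm_mul, Complex.norm_natCast]
    calc (n : ℝ) * ‖C n‖ ≤ n * ((√n)⁻¹ * |b n| * ∫ p, |T p * S p| ∂ν) := by gcongr
      _ = _ := by
        rw [← mul_assoc, ← mul_assoc, ← div_eq_mul_inv, div_sqrt]
  have hsum := ((tendsto_mul_integral_cexp_sub_one hTm hT hT0).add hS).add hcross
  rw [add_zero] at hsum
  refine hsum.congr fun n => ?_
  have i1 := hint (fun p => (√n)⁻¹ * T p) (by fun_prop)
  have i2 := hint (fun p => b n * S p) (by fun_prop)
  have i3 := hint (fun p => (√n)⁻¹ * T p + b n * S p) (by fun_prop)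
  have hpt p : (Complex.exp (Complex.I * ((√n)⁻¹ * T p : ℝ)) - 1) *
      (Complex.exp (Complex.I * (b n * S p : ℝ)) - 1) =
      Complex.exp (Complex.I * ((√n)⁻¹ * T p + b n * S p : ℝ)) -
        Complex.exp (Complex.I * ((√n)⁻¹ * T p : ℝ)) -
        Complex.exp (Complex.I * (b n * S p : ℝ)) + 1 := by
    rw [Complex.ofReal_add, mul_add, Complex.exp_add]; ring
  have hCn : C n = ∫ p, Complex.exp (Complex.I * ((√n)⁻¹ * T p + b n * S p : ℝ)) ∂ν -
      ∫ p, Complex.exp (Complex.I * ((√n)⁻¹ * T p : ℝ)) ∂ν -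
      ∫ p, Complex.exp (Complex.I * (b n * S p : ℝ)) ∂ν + 1 := by
    simp only [hC, hpt]
    rw [integral_add, integral_sub, integral_sub i3 i1]
    · simp
    · exact i3.sub i1
    · exact i2
    · exact (i3.sub i1).sub i2
    · exact integrable_const _
  rw [hCn]; ring

/-- The law of `(X, Z)` with `X` exponential of rate `β` and `Z` standard normal, independent. -/
noncomputable abbrev expNormal (β : ℝ) : Measure (ℝ × ℝ) := (gammaMeasure 1 β).prod (gaussianReal 0 1)

lemma ae_expNormal_pos {β : ℝ} (hβ : 0 < β) : ∀ᵐ p ∂expNormal β, 0 < p.1 := by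
  have := isProbabilityMeasure_gammaMeasure one_pos hβ
  exact (Measure.quasiMeasurePreserving_fst (μ := gammaMeasure 1 β)
    (ν := gaussianReal 0 1)).ae (ae_gammaMeasure_pos 1 β)

/-- Given `X = x`, the variable `Z / √x` is centered normal with variance `1 / x`; integrating out
`Z` leaves the Laplace transform of `1 / X` at `b ^ 2 / 2`. -/
lemma integral_cexp_div_sqrt {β : ℝ} (hβ : 0 < β) (b : ℝ) :
    ∫ p, Complex.exp (Complex.I * (b * (p.2 / √p.1) : ℝ)) ∂expNormal β =
      ((∫ x, exp (-(b ^ 2 / 2 / x)) ∂gammaMeasure 1 β : ℝ) : ℂ) := by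
  have := isProbabilityMeasure_gammaMeasure one_pos hβ
  rw [integral_prod, ← integral_complex_ofReal]
  · refine integral_congr_ae ?_
    filter_upwards [ae_gammaMeasure_pos 1 β] with x hx
    have h := charFun_gaussianReal (μ := 0) (v := 1) (b / √x)
    rw [charFun_apply_real] at h
    calc _ = ∫ z, Complex.exp (((b / √x : ℝ) : ℂ) * z * Complex.I) ∂gaussianReal 0 1 := by
          refine integral_congr_ae (ae_of_all _ fun z => ?_)
          simp only; congr 1; push_cast; ring
      _ = _ := by
          rw [h, Complex.ofReal_exp]
          congr 1
          have : (b / √x) ^ 2 = b ^ 2 / x := by rw [div_pow, sq_sqrt hx.le]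
          rw [← Complex.ofReal_pow, this]
          push_cast; simp; ring
  · refine Integrable.of_bound (Measurable.aestronglyMeasurable (by fun_prop)) 1
      (ae_of_all _ fun p => ?_)
    rw [Complex.norm_exp_I_mul_ofReal]

lemma tendsto_mul_integral_cexp_div_sqrt {β : ℝ} (hβ : 0 < β) (c : ℝ) :
    Tendsto (fun n : ℕ => (n : ℂ) * (∫ p, Complex.exp (Complex.I *
      ((√(n * log n))⁻¹ * c * (p.2 / √p.1) : ℝ)) ∂expNormal β - 1)) atTop
      (𝓝 (-((c ^ 2 * β : ℝ) / 2))) := by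
  have := isProbabilityMeasure_gammaMeasure one_pos hβ
  rcases eq_or_ne c 0 with rfl | hc
  · simp
  have h := tendsto_mul_integral_one_sub_exp hβ (κ := c ^ 2 / 2) (by positivity)
  have h2 := (Complex.continuous_ofReal.tendsto _).comp h.neg
  refine Tendsto.congr (fun n => ?_) (h2.trans_eq ?_)
  · rw [integral_cexp_div_sqrt hβ]
    have hlog : 0 ≤ (n : ℝ) * log n := mul_nonneg n.cast_nonneg (log_natCast_nonneg n)
    have e : ((√(n * log n))⁻¹ * c) ^ 2 / 2 = c ^ 2 / 2 / (n * log n) := by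
      rw [mul_pow, inv_pow, sq_sqrt hlog]; ring
    rw [e]
    have hint : Integrable (fun x => exp (-(c ^ 2 / 2 / (n * log n) / x))) (gammaMeasure 1 β) := by
      refine Integrable.of_bound (by fun_prop) 1 ?_
      filter_upwards [ae_gammaMeasure_pos 1 β] with x hx
      rw [norm_of_nonneg (exp_pos _).le, exp_le_one_iff]
      simp only [Left.neg_nonpos_iff]
      positivity
    rw [Function.comp_apply, integral_sub (integrable_const _) hint]
    simp only [integral_const, probReal_univ, smul_eq_mul, mul_one]
    push_cast; ring
  · congr 1; push_cast; ring

/-! ### Moments of the summands -/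

section Moments

variable {β : ℝ}

/-- Powers of an exponential variable are integrable for exponents above `-1`. Bounding the
logarithm by quarter powers keeps the worst exponent at `-1/2 - 1/4 = -3/4`. -/
lemma integrable_log_mul_inv_sqrt (hβ : 0 < β) (a b c : ℝ) :
    Integrable (fun x => (a * log x + b * x + c) * (√x)⁻¹) (gammaMeasure 1 β) := by
  have := isProbabilityMeasure_gammaMeasure one_pos hβ
  have g (p : ℝ) (hp : 0 < 1 + p) : Integrable (fun x => exp (p * log x)) (gammaMeasure 1 β) := by
    simpa using integrable_exp_log_gammaMeasure (q := 0) one_pos hβ hp (by simpa using hβ)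
  have hdom := (((g (-1/4) (by norm_num)).add (g (-3/4) (by norm_num))).const_mul (4 * |a|)).add
    (((g (1/2) (by norm_num)).const_mul |b|).add ((g (-1/2) (by norm_num)).const_mul |c|))
  refine hdom.mono' (by fun_prop) ?_
  filter_upwards [ae_gammaMeasure_pos 1 β] with x hx
  have hs : √x = exp (1/2 * log x) := by
    rw [sqrt_eq_rpow, rpow_def_of_pos hx, mul_comm]
  have hs' : (√x)⁻¹ = exp (-1/2 * log x) := by rw [hs, ← exp_neg]; ring_nf
  have hx' : x * (√x)⁻¹ = √x := by rw [← div_eq_mul_inv, div_sqrt]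
  have hl : |log x| ≤ 4 * (exp (1/4 * log x) + exp (-1/4 * log x)) := by
    have h1 := add_one_le_exp (1/4 * log x)
    have h2 := add_one_le_exp (-1/4 * log x)
    have h3 := exp_pos (1/4 * log x)
    have h4 := exp_pos (-1/4 * log x)
    rw [abs_le]; constructor <;> linarith
  have e1 : exp (1/4 * log x) * exp (-1/2 * log x) = exp (-1/4 * log x) := by
    rw [← exp_add]; ring_nf
  have e2 : exp (-1/4 * log x) * exp (-1/2 * log x) = exp (-3/4 * log x) := by
    rw [← exp_add]; ring_nf
  have e3 : (a * log x + b * x + c) * (√x)⁻¹ =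
      a * (log x * (√x)⁻¹) + b * √x + c * (√x)⁻¹ := by
    have hb : b * √x = b * (x * (√x)⁻¹) := by rw [hx']
    rw [hb]
    ring
  simp only [Pi.add_apply]
  rw [e3]
  have t1 : ‖a * (log x * (√x)⁻¹)‖ ≤ 4 * |a| * (exp (-1/4 * log x) + exp (-3/4 * log x)) := by
    rw [norm_mul, norm_mul, norm_of_nonneg (inv_nonneg.2 (sqrt_nonneg x)), hs', ← e2, ← e1,
      ← add_mul, Real.norm_eq_abs, Real.norm_eq_abs, mul_comm 4 |a|, mul_assoc |a|, ← mul_assoc 4]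
    gcongr
    rw [e1]; exact hl
  have t2 : ‖b * √x‖ ≤ |b| * exp (1/2 * log x) := by
    rw [norm_mul, norm_of_nonneg (sqrt_nonneg x), hs, Real.norm_eq_abs]
  have t3 : ‖c * (√x)⁻¹‖ ≤ |c| * exp (-1/2 * log x) := by
    rw [norm_mul, norm_of_nonneg (inv_nonneg.2 (sqrt_nonneg x)), hs', Real.norm_eq_abs]
  refine (norm_add₃_le).trans ?_
  linarith

/-- The square integrable part of the summands, a function of `(X, Z)`. -/
noncomputable def finVar (β a b r s : ℝ) (p : ℝ × ℝ) : ℝ :=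
  (a * log p.1 + b * p.1 - (a * (digamma 1 - log β) + b * (1 / β))) + r * √p.1 * p.2 +
    s * (p.2 ^ 2 - 1)

lemma measurable_finVar (a b r s : ℝ) : Measurable (finVar β a b r s) := by
  unfold finVar; fun_prop

lemma memLp_log_sub (hβ : 0 < β) (a b : ℝ) :
    MemLp (fun x => a * log x + b * x - (a * (digamma 1 - log β) + b * (1 / β))) 2
      (gammaMeasure 1 β) := by
  have := isProbabilityMeasure_gammaMeasure one_pos hβ
  exact (integrable_gammaMeasure_log one_pos hβ a b).sub (memLp_const _)

lemma integral_log_sub (hβ : 0 < β) (a b : ℝ) :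
    ∫ x, (a * log x + b * x - (a * (digamma 1 - log β) + b * (1 / β))) ∂gammaMeasure 1 β = 0 := by
  have := isProbabilityMeasure_gammaMeasure one_pos hβ
  rw [integral_sub ((integrable_gammaMeasure_log one_pos hβ a b).integrable one_le_two)
    (integrable_const _), integral_gammaMeasure_log one_pos hβ]
  simp

lemma integrable_id_gammaMeasure (hβ : 0 < β) : Integrable (fun x => x) (gammaMeasure 1 β) := by
  have := isProbabilityMeasure_gammaMeasure one_pos hβ
  simpa using (integrable_gammaMeasure_log one_pos hβ 0 1).integrable one_le_two

lemma memLp_sqrt (hβ : 0 < β) : MemLp (fun x => √x) 2 (gammaMeasure 1 β) := by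
  rw [memLp_two_iff_integrable_sq (by fun_prop)]
  refine (integrable_id_gammaMeasure hβ).congr ?_
  filter_upwards [ae_gammaMeasure_pos 1 β] with x hx
  rw [sq_sqrt hx.le]

lemma integral_sqrt_sq (hβ : 0 < β) : ∫ x, √x ^ 2 ∂gammaMeasure 1 β = 1 / β := by
  have h : ∫ x, √x ^ 2 ∂gammaMeasure 1 β = ∫ x, (0 * log x + 1 * x) ∂gammaMeasure 1 β := by
    refine integral_congr_ae ?_
    filter_upwards [ae_gammaMeasure_pos 1 β] with x hx
    rw [sq_sqrt hx.le]; ring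
  rw [h, integral_gammaMeasure_log one_pos hβ]; ring

lemma integrable_sq_sub_one : Integrable (fun z : ℝ => z ^ 2 - 1) (gaussianReal 0 1) :=
  (integrable_pow_gaussianReal 2).sub (integrable_const _)

lemma integral_sq_sub_one : ∫ z : ℝ, (z ^ 2 - 1) ∂gaussianReal 0 1 = 0 := by
  rw [integral_sub (integrable_pow_gaussianReal 2) (integrable_const _),
    integral_pow_gaussianReal_zero_one.2.1]
  simp

lemma integral_finVar (hβ : 0 < β) (a b r s : ℝ) :
    ∫ p, finVar β a b r s p ∂expNormal β = 0 := by
  have := isProbabilityMeasure_gammaMeasure one_pos hβ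
  have j1 : Integrable (fun x => r * √x) (gammaMeasure 1 β) :=
    ((memLp_sqrt hβ).integrable one_le_two).const_mul r
  have hz : Integrable (fun z : ℝ => z) (gaussianReal 0 1) := by
    simpa using integrable_pow_gaussianReal 1
  have i1 := ((memLp_log_sub hβ a b).integrable one_le_two).mul_prod
    (integrable_const (μ := gaussianReal 0 1) (1 : ℝ))
  have i2 := j1.mul_prod hz
  have i3 := (integrable_const (μ := gammaMeasure 1 β) s).mul_prod integrable_sq_sub_one
  have e : finVar β a b r s = fun p : ℝ × ℝ =>
      (a * log p.1 + b * p.1 - (a * (digamma 1 - log β) + b * (1 / β))) * 1 + (r * √p.1) * p.2 +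
      s * (p.2 ^ 2 - 1) := by
    ext p; rw [finVar, mul_one]
  rw [e]
  simp only
  rw [integral_add (i1.fun_add i2) i3, integral_add i1 i2,
    integral_prod_mul (fun x => a * log x + b * x - (a * (digamma 1 - log β) + b * (1 / β)))
      (fun _ : ℝ => (1 : ℝ)),
    integral_prod_mul (fun x => r * √x) (fun z : ℝ => z),
    integral_prod_mul (fun _ : ℝ => s) (fun z : ℝ => z ^ 2 - 1), integral_log_sub hβ,
    integral_pow_gaussianReal_zero_one.1, integral_sq_sub_one]
  simp

/-- The three cross products vanish because `Z`, `Z ^ 2 - 1` and `Z * (Z ^ 2 - 1)` have mean zero.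
This is why the limiting blocks for `(α, β)`, `μ` and `υ` are independent. -/
lemma integrable_finVar_sq (hβ : 0 < β) (a b r s : ℝ) :
    Integrable (fun p => finVar β a b r s p ^ 2) (expNormal β) ∧
    ∫ p, finVar β a b r s p ^ 2 ∂expNormal β =
      a ^ 2 * deriv digamma 1 + 2 * a * b / β + b ^ 2 / β ^ 2 + r ^ 2 / β + 2 * s ^ 2 := by
  have := isProbabilityMeasure_gammaMeasure one_pos hβ
  obtain ⟨z1, z2, z3, z4⟩ := integral_pow_gaussianReal_zero_one
  have p1 : Integrable (fun z : ℝ => z) (gaussianReal 0 1) := by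
    simpa using integrable_pow_gaussianReal 1
  have p2 := integrable_pow_gaussianReal 2
  have p3 := integrable_pow_gaussianReal 3
  have p4 := integrable_pow_gaussianReal 4
  set f : ℝ → ℝ := fun x => a * log x + b * x - (a * (digamma 1 - log β) + b * (1 / β)) with hf
  have f2 : MemLp f 2 (gammaMeasure 1 β) := memLp_log_sub hβ a b
  have fs : Integrable (fun x => f x * √x) (gammaMeasure 1 β) := f2.integrable_mul (memLp_sqrt hβ)
  have g2 : Integrable (fun z : ℝ => (z ^ 2 - 1) ^ 2) (gaussianReal 0 1) := by
    refine ((p4.sub (p2.const_mul 2)).add (integrable_const 1)).congr (ae_of_all _ fun z => ?_)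
    simp only [Pi.add_apply, Pi.sub_apply]; ring
  have g3 : Integrable (fun z : ℝ => z * (z ^ 2 - 1)) (gaussianReal 0 1) := by
    refine (p3.sub p1).congr (ae_of_all _ fun z => ?_)
    simp only [Pi.sub_apply]; ring
  have v2 : ∫ z : ℝ, (z ^ 2 - 1) ^ 2 ∂gaussianReal 0 1 = 2 := by
    have e : ∀ z : ℝ, (z ^ 2 - 1) ^ 2 = z ^ 4 - 2 * z ^ 2 + 1 := fun z => by ring
    simp_rw [e]
    have k : Integrable (fun z : ℝ => z ^ 4 - 2 * z ^ 2) (gaussianReal 0 1) :=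
      p4.sub (p2.const_mul 2)
    rw [integral_add k (integrable_const _),
      integral_sub p4 (p2.const_mul 2), integral_const_mul, z2, z4]
    simp; norm_num
  have v3 : ∫ z : ℝ, z * (z ^ 2 - 1) ∂gaussianReal 0 1 = 0 := by
    have e : ∀ z : ℝ, z * (z ^ 2 - 1) = z ^ 3 - z := fun z => by ring
    simp_rw [e]
    rw [integral_sub p3 p1, z1, z3, sub_zero]
  have i1 := f2.integrable_sq.mul_prod (integrable_const (μ := gaussianReal 0 1) (1 : ℝ))
  have i2 := ((memLp_sqrt hβ).integrable_sq.const_mul (r ^ 2)).mul_prod p2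
  have i3 := (integrable_const (μ := gammaMeasure 1 β) (s ^ 2)).mul_prod g2
  have i4 := (fs.const_mul (2 * r)).mul_prod p1
  have i5 := ((f2.integrable one_le_two).const_mul (2 * s)).mul_prod integrable_sq_sub_one
  have i6 := (((memLp_sqrt hβ).integrable one_le_two).const_mul (2 * r * s)).mul_prod g3
  have e : (fun p => finVar β a b r s p ^ 2) = fun p : ℝ × ℝ =>
      f p.1 ^ 2 * 1 + (r ^ 2 * √p.1 ^ 2) * p.2 ^ 2 + s ^ 2 * (p.2 ^ 2 - 1) ^ 2 +
      (2 * r * (f p.1 * √p.1)) * p.2 + (2 * s * f p.1) * (p.2 ^ 2 - 1) +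
      (2 * r * s * √p.1) * (p.2 * (p.2 ^ 2 - 1)) := by
    ext p; rw [finVar]; ring
  have k2 := i1.fun_add i2
  have k3 := k2.fun_add i3
  have k4 := k3.fun_add i4
  have k5 := k4.fun_add i5
  have k6 := k5.fun_add i6
  rw [e]
  refine ⟨k6, ?_⟩
  rw [integral_add k5 i6, integral_add k4 i5, integral_add k3 i4, integral_add k2 i3,
    integral_add i1 i2,
    integral_prod_mul (fun x => f x ^ 2) (fun _ : ℝ => (1 : ℝ)),
    integral_prod_mul (fun x => r ^ 2 * √x ^ 2) (fun z : ℝ => z ^ 2),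
    integral_prod_mul (fun _ : ℝ => s ^ 2) (fun z : ℝ => (z ^ 2 - 1) ^ 2),
    integral_prod_mul (fun x => 2 * r * (f x * √x)) (fun z : ℝ => z),
    integral_prod_mul (fun x => 2 * s * f x) (fun z : ℝ => z ^ 2 - 1),
    integral_prod_mul (fun x => 2 * r * s * √x) (fun z : ℝ => z * (z ^ 2 - 1)),
    integral_sq_sub_one, v2, v3, z1, z2, integral_const_mul, integral_sqrt_sq hβ,
    integral_sq_gammaMeasure_log one_pos hβ]
  simp only [integral_const, probReal_univ, smul_eq_mul]
  ring

lemma memLp_finVar (hβ : 0 < β) (a b r s : ℝ) : MemLp (finVar β a b r s) 2 (expNormal β) :=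
  (memLp_two_iff_integrable_sq (measurable_finVar a b r s).aestronglyMeasurable).2
    (integrable_finVar_sq hβ a b r s).1

/-- This is the integrability needed to decouple the summand `Z / √X`, which itself has infinite
variance: the products involve only `1 / √X` times a logarithm or a polynomial in `X` and `Z`. -/
lemma integrable_finVar_mul (hβ : 0 < β) (a b r s : ℝ) :
    Integrable (fun p => finVar β a b r s p * (p.2 / √p.1)) (expNormal β) := by
  have := isProbabilityMeasure_gammaMeasure one_pos hβ
  have p1 : Integrable (fun z : ℝ => z) (gaussianReal 0 1) := by
    simpa using integrable_pow_gaussianReal 1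
  have p3 := integrable_pow_gaussianReal 3
  have i1 := (integrable_log_mul_inv_sqrt hβ a b (-(a * (digamma 1 - log β) + b * (1 / β)))).mul_prod
    p1
  have i2 := (integrable_const (μ := gammaMeasure 1 β) r).mul_prod (integrable_pow_gaussianReal 2)
  have i3 := (integrable_log_mul_inv_sqrt hβ 0 0 s).mul_prod (p3.sub p1)
  refine ((i1.add i2).add i3).congr ?_
  filter_upwards [ae_expNormal_pos hβ] with p hp
  have hs : √p.1 ≠ 0 := (sqrt_pos.2 hp).ne'
  simp only [Pi.add_apply, Pi.sub_apply, finVar]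
  field_simp
  ring

end Moments

lemma tendsto_pow_integral_cexp {β : ℝ} (hβ : 0 < β) (a b c r s : ℝ) :
    Tendsto (fun n : ℕ => (∫ p, Complex.exp (Complex.I *
      ((√n)⁻¹ * finVar β a b r s p + (√(n * log n))⁻¹ * c * (p.2 / √p.1) : ℝ)) ∂expNormal β) ^ n)
      atTop (𝓝 (Complex.exp (-((a ^ 2 * deriv digamma 1 + 2 * a * b / β + b ^ 2 / β ^ 2 +
        r ^ 2 / β + 2 * s ^ 2 + c ^ 2 * β : ℝ) / 2)))) := by
  have := isProbabilityMeasure_gammaMeasure one_pos hβ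
  -- The additional factor `√(log n)` in the norming of the intercept makes the cross term vanish.
  have hb : Tendsto (fun n : ℕ => √n * |(√(n * log n))⁻¹ * c|) atTop (𝓝 0) := by
    have h : Tendsto (fun n : ℕ => (√(log n))⁻¹ * |c|) atTop (𝓝 (0 * |c|)) :=
      (tendsto_inv_atTop_zero.comp (tendsto_sqrt_atTop.comp
        (tendsto_log_atTop.comp tendsto_natCast_atTop_atTop))).mul_const _
    rw [zero_mul] at h
    refine h.congr' ?_
    filter_upwards [eventually_gt_atTop 0] with n hn
    have hn' : 0 < √(n : ℝ) := sqrt_pos.2 (by exact_mod_cast hn)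
    rw [abs_mul, sqrt_mul n.cast_nonneg, abs_of_nonneg (a := (√(n : ℝ) * √(log n))⁻¹) (by positivity),
      mul_inv]
    field_simp
  have h := tendsto_mul_integral_cexp_add_sub_one (measurable_finVar a b r s)
    (by fun_prop : Measurable fun p : ℝ × ℝ => p.2 / √p.1) (memLp_finVar hβ a b r s)
    (integral_finVar hβ a b r s) (integrable_finVar_mul hβ a b r s) hb
    (tendsto_mul_integral_cexp_div_sqrt hβ c)
  have h2 := Complex.tendsto_one_add_pow_exp_of_tendsto h
  refine Tendsto.congr (fun n => ?_) (h2.trans_eq ?_)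
  · simp
  · rw [(integrable_finVar_sq hβ a b r s).2]
    congr 2
    push_cast; ring

/-! ### Joint central limit theorem -/

/-- The contribution of one observation `(X, Z)` to the asymptotically linear expansion of the
normalized estimator. -/
noncomputable def influence (β σ : ℝ) (n : ℕ) (p : ℝ × ℝ) : Fin 5 → ℝ :=
  ![(√n)⁻¹ * ((deriv digamma 1 - 1)⁻¹ *
      (log p.1 - (digamma 1 - log β) - β * (p.1 - 1 / β))),
    (√n)⁻¹ * (β * ((deriv digamma 1 - 1)⁻¹ *
      (log p.1 - (digamma 1 - log β) - β * (p.1 - 1 / β))) - β ^ 2 * (p.1 - 1 / β)),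
    (√(n * log n))⁻¹ * (σ / β * (p.2 / √p.1)),
    (√n)⁻¹ * (β * σ * (√p.1 * p.2)),
    (√n)⁻¹ * (σ ^ 2 * (p.2 ^ 2 - 1))]

lemma measurable_influence (β σ : ℝ) (n : ℕ) : Measurable (influence β σ n) := by
  refine measurable_pi_iff.2 fun i => ?_
  unfold influence
  fin_cases i <;> simp <;> fun_prop

/-- The Cramér–Wold reduction: every linear combination of the five coordinates is one square
integrable variable plus a multiple of `Z / √X`. -/
lemma sum_mul_influence (β σ : ℝ) (n : ℕ) (u : Fin 5 → ℝ) (p : ℝ × ℝ) :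
    ∑ j, u j * influence β σ n p j =
      (√n)⁻¹ * finVar β ((deriv digamma 1 - 1)⁻¹ * (u 0 + β * u 1))
        (-β * ((deriv digamma 1 - 1)⁻¹ * (u 0 + β * u 1)) - β ^ 2 * u 1) (u 3 * (β * σ))
        (u 4 * σ ^ 2) p + (√(n * log n))⁻¹ * (u 2 * (σ / β)) * (p.2 / √p.1) := by
  simp only [Fin.sum_univ_five, influence, finVar, Matrix.cons_val]
  ring

/-- Completing the square reduces the claim to `ψ'(1) > 1`. It is required to evaluate the
characteristic function of the bivariate Gaussian block. -/
lemma posSemidef_covShapeRate {β : ℝ} : (covShapeRate 1 β).PosSemidef := by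
  have h := inv_lt_deriv_digamma one_pos
  rw [inv_one] at h
  refine PosSemidef.of_dotProduct_mulVec_nonneg ?_ fun x => ?_
  · ext i j
    fin_cases i <;> fin_cases j <;> simp [covShapeRate]
  · have e : star x ⬝ᵥ covShapeRate 1 β *ᵥ x = (deriv digamma 1 - 1)⁻¹ *
        ((x 0 + β * x 1) ^ 2 + β ^ 2 * (deriv digamma 1 - 1) * x 1 ^ 2) := by
      simp [covShapeRate, dotProduct, mulVec, Fin.sum_univ_two]
      ring
    rw [e]
    have h0 : 0 ≤ deriv digamma 1 - 1 := by linarith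
    positivity

lemma charFun_limitBlocks {β σ : ℝ} (hβ : 0 < β) (hσ : 0 < σ) (u : EuclideanSpace ℝ (Fin 5)) :
    charFun ((limitBlocks β σ).map (fun w => WithLp.toLp 2 (assemble w))) u =
      Complex.exp (-(((deriv digamma 1 - 1)⁻¹ *
        ((u 0) ^ 2 + 2 * β * u 0 * u 1 + β ^ 2 * deriv digamma 1 * u 1 ^ 2) +
        u 2 ^ 2 * (σ ^ 2 / β) + u 3 ^ 2 * (σ ^ 2 * β) + u 4 ^ 2 * (2 * σ ^ 4) : ℝ) / 2)) := by
  have hm : Continuous (fun w => (WithLp.toLp 2 (assemble w) : EuclideanSpace ℝ (Fin 5))) := by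
    refine (PiLp.continuous_toLp 2 _).comp (continuous_pi fun i => ?_)
    fin_cases i <;> simp [assemble] <;> fun_prop
  rw [charFun_apply, integral_map hm.aemeasurable (by fun_prop)]
  have e w : Complex.exp (inner ℝ (WithLp.toLp 2 (assemble w)) u * Complex.I) =
      Complex.exp (inner ℝ w.1 !₂[u 0, u 1] * Complex.I) * (Complex.exp (u 2 * w.2.1 * Complex.I) *
        (Complex.exp (u 3 * w.2.2.1 * Complex.I) * Complex.exp (u 4 * w.2.2.2 * Complex.I))) := by
    rw [← Complex.exp_add, ← Complex.exp_add, ← Complex.exp_add]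
    congr 1
    simp [PiLp.inner_apply, Fin.sum_univ_five, Fin.sum_univ_two, assemble]
    ring
  simp only [e]
  rw [integral_prod_mul (fun w : EuclideanSpace ℝ (Fin 2) =>
      Complex.exp (inner ℝ w !₂[u 0, u 1] * Complex.I))
      (fun w : ℝ × ℝ × ℝ => Complex.exp (u 2 * w.1 * Complex.I) *
        (Complex.exp (u 3 * w.2.1 * Complex.I) * Complex.exp (u 4 * w.2.2 * Complex.I))),
    integral_prod_mul (fun w : ℝ => Complex.exp (u 2 * w * Complex.I))
      (fun w : ℝ × ℝ => Complex.exp (u 3 * w.1 * Complex.I) *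
        Complex.exp (u 4 * w.2 * Complex.I)),
    integral_prod_mul (fun w : ℝ => Complex.exp (u 3 * w * Complex.I))
      (fun w : ℝ => Complex.exp (u 4 * w * Complex.I)),
    ← charFun_apply, ← charFun_apply_real, ← charFun_apply_real, ← charFun_apply_real,
    charFun_gaussianReal, charFun_gaussianReal, charFun_gaussianReal,
    charFun_multivariateGaussian posSemidef_covShapeRate,
    ← Complex.exp_add, ← Complex.exp_add, ← Complex.exp_add]
  congr 1
  have h1 : (((σ ^ 2 / β).toNNReal : ℝ) : ℂ) = ((σ ^ 2 / β : ℝ) : ℂ) := by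
    rw [coe_toNNReal _ (by positivity)]
  have h2 : (((σ ^ 2 * β).toNNReal : ℝ) : ℂ) = ((σ ^ 2 * β : ℝ) : ℂ) := by
    rw [coe_toNNReal _ (by positivity)]
  have h3 : (((2 * σ ^ 4).toNNReal : ℝ) : ℂ) = ((2 * σ ^ 4 : ℝ) : ℂ) := by
    rw [coe_toNNReal _ (by positivity)]
  rw [h1, h2, h3]
  simp [covShapeRate, dotProduct, mulVec, Fin.sum_univ_two]
  ring

lemma tendstoInDistribution_sum_influence {Ω : Type*} [MeasurableSpace Ω] {P : Measure Ω}
    [IsProbabilityMeasure P] {β σ : ℝ} (hβ : 0 < β) (hσ : 0 < σ) {V : ℕ → Ω → ℝ × ℝ}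
    (hV : iIndepFun V P) (hlaw : ∀ i, HasLaw (V i) (expNormal β) P) :
    TendstoInDistribution
      (fun (n : ℕ) ω => ∑ i ∈ Finset.range n, influence β σ n (V i ω))
      atTop assemble (fun _ => P) (limitBlocks β σ) := by
  have := isProbabilityMeasure_gammaMeasure one_pos hβ
  have h := inv_lt_deriv_digamma one_pos
  rw [inv_one] at h
  have hVm i := (hlaw i).aemeasurable
  -- Lévy's continuity theorem needs an inner product, which `Fin 5 → ℝ` with its sup norm lacks;
  -- the result is carried back by a continuous map at the end.
  let J : ℕ → ℝ × ℝ → EuclideanSpace ℝ (Fin 5) := fun n p => WithLp.toLp 2 (influence β σ n p)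
  have hJm n : Measurable (J n) :=
    (PiLp.continuous_toLp 2 _).measurable.comp (measurable_influence β σ n)
  have hJVm n i : AEMeasurable (fun ω => J n (V i ω)) P := (hJm n).comp_aemeasurable (hVm i)
  have hE : TendstoInDistribution
      (fun (n : ℕ) ω => ∑ i ∈ Finset.range n, J n (V i ω))
      atTop (fun w => WithLp.toLp 2 (assemble w)) (fun _ => P) (limitBlocks β σ) := by
    refine ⟨fun n => Finset.aemeasurable_fun_sum _ fun i _ => hJVm n i, ?_, ?_⟩
    · refine Continuous.aemeasurable ?_
      refine (PiLp.continuous_toLp 2 _).comp (continuous_pi fun i => ?_)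
      fin_cases i <;> simp [assemble] <;> fun_prop
    · refine ProbabilityMeasure.tendsto_iff_tendsto_charFun.2 fun u => ?_
      simp only [ProbabilityMeasure.coe_mk]
      rw [charFun_limitBlocks hβ hσ]
      have hlim := tendsto_pow_integral_cexp hβ ((deriv digamma 1 - 1)⁻¹ * (u 0 + β * u 1))
        (-β * ((deriv digamma 1 - 1)⁻¹ * (u 0 + β * u 1)) - β ^ 2 * u 1) (u 2 * (σ / β))
        (u 3 * (β * σ)) (u 4 * σ ^ 2)
      refine Tendsto.congr (fun n => ?_) (hlim.trans_eq ?_)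
      · have hind : iIndepFun (fun i ω => J n (V i ω)) P := hV.comp (fun _ => J n) fun _ => hJm n
        rw [(hind.restrict _).charFun_map_fun_finsetSum_eq_prod fun i _ => hJVm n i]
        simp only [Finset.prod_apply]
        rw [Finset.prod_congr rfl (g := fun _ => _) fun i _ => ?_, Finset.prod_const,
          Finset.card_range]
        rw [show (fun ω => J n (V i ω)) = J n ∘ V i from rfl,
          ← AEMeasurable.map_map_of_aemeasurable (hJm n).aemeasurable (hVm i), (hlaw i).map_eq,
          charFun_apply, integral_map (hJm n).aemeasurable (by fun_prop)]
        refine integral_congr_ae (ae_of_all _ fun p => ?_)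
        simp only
        rw [← sum_mul_influence, mul_comm]
        congr 2
      · congr 3
        have : deriv digamma 1 - 1 ≠ 0 := by linarith
        norm_cast
        field_simp
        ring
  refine TendstoInDistribution.congr (fun n => ae_of_all _ fun ω => ?_) (ae_of_all _ fun w => rfl)
    (hE.continuous_comp (PiLp.continuous_ofLp 2 _))
  simp [J]

/-! ### Boundedness in probability -/

section Prob

variable {Ω : Type*} [MeasurableSpace Ω] {P : Measure Ω}

/-- The sequence `f` is bounded in probability. -/
def BoundedInProb (P : Measure Ω) (f : ℕ → Ω → ℝ) : Prop :=
  ∀ η : ENNReal, 0 < η → ∃ M : ℝ, ∀ n, P {ω | M < |f n ω|} ≤ η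

lemma BoundedInProb.exists_pos {f : ℕ → Ω → ℝ} (hf : BoundedInProb P f) {η : ENNReal}
    (hη : 0 < η) : ∃ M : ℝ, 0 < M ∧ ∀ n, P {ω | M < |f n ω|} ≤ η := by
  obtain ⟨M, hM⟩ := hf η hη
  refine ⟨max M 1, by positivity, fun n => (measure_mono fun ω hω => ?_).trans (hM n)⟩
  exact (le_max_left M 1).trans_lt hω

lemma BoundedInProb.mono {f g : ℕ → Ω → ℝ} (hf : BoundedInProb P f)
    (h : ∀ n ω, |g n ω| ≤ |f n ω|) : BoundedInProb P g := fun η hη => by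
  obtain ⟨M, hM⟩ := hf η hη
  exact ⟨M, fun n => (measure_mono fun ω hω => lt_of_lt_of_le hω (h n ω)).trans (hM n)⟩

lemma BoundedInProb.add {f g : ℕ → Ω → ℝ} (hf : BoundedInProb P f) (hg : BoundedInProb P g) :
    BoundedInProb P (fun n ω => f n ω + g n ω) := fun η hη => by
  obtain ⟨M, hM⟩ := hf (η / 2) (ENNReal.half_pos hη.ne')
  obtain ⟨N, hN⟩ := hg (η / 2) (ENNReal.half_pos hη.ne')
  refine ⟨M + N, fun n => ?_⟩
  calc P {ω | M + N < |f n ω + g n ω|} ≤ P ({ω | M < |f n ω|} ∪ {ω | N < |g n ω|}) := by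
        refine measure_mono fun ω hω => ?_
        by_contra hc
        simp only [Set.mem_union, Set.mem_ofPred_eq, not_or, not_lt] at hc hω
        linarith [abs_add_le (f n ω) (g n ω)]
    _ ≤ η / 2 + η / 2 := (measure_union_le _ _).trans (add_le_add (hM n) (hN n))
    _ = η := ENNReal.add_halves η

lemma BoundedInProb.mul {f g : ℕ → Ω → ℝ} (hf : BoundedInProb P f) (hg : BoundedInProb P g) :
    BoundedInProb P (fun n ω => f n ω * g n ω) := fun η hη => by
  obtain ⟨M, hM0, hM⟩ := hf.exists_pos (ENNReal.half_pos hη.ne')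
  obtain ⟨N, hN0, hN⟩ := hg.exists_pos (ENNReal.half_pos hη.ne')
  refine ⟨M * N, fun n => ?_⟩
  calc P {ω | M * N < |f n ω * g n ω|} ≤ P ({ω | M < |f n ω|} ∪ {ω | N < |g n ω|}) := by
        refine measure_mono fun ω hω => ?_
        by_contra hc
        simp only [Set.mem_union, Set.mem_ofPred_eq, not_or, not_lt] at hc hω
        rw [abs_mul] at hω
        exact absurd hω (not_lt.2 (mul_le_mul hc.1 hc.2 (abs_nonneg _) hM0.le))
    _ ≤ η / 2 + η / 2 := (measure_union_le _ _).trans (add_le_add (hM n) (hN n))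
    _ = η := ENNReal.add_halves η

lemma BoundedInProb.const_mul {f : ℕ → Ω → ℝ} (hf : BoundedInProb P f) (c : ℝ) :
    BoundedInProb P (fun n ω => c * f n ω) := fun η hη => by
  obtain ⟨M, hM⟩ := hf η hη
  refine ⟨|c| * M, fun n => (measure_mono fun ω hω => ?_).trans (hM n)⟩
  simp only [Set.mem_ofPred_eq, abs_mul] at hω ⊢
  exact lt_of_mul_lt_mul_left hω (abs_nonneg c)

lemma BoundedInProb.mul_tendstoInMeasure {f e : ℕ → Ω → ℝ} (hf : BoundedInProb P f)
    (he : TendstoInMeasure P e atTop (fun _ => 0)) :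
    TendstoInMeasure P (fun n ω => f n ω * e n ω) atTop (fun _ => 0) := by
  rw [tendstoInMeasure_iff_dist] at he ⊢
  intro δ hδ
  rw [ENNReal.tendsto_nhds_zero]
  intro η hη
  obtain ⟨M, hM0, hM⟩ := hf.exists_pos (ENNReal.half_pos hη.ne')
  have h := ENNReal.tendsto_nhds_zero.1 (he (δ / M) (by positivity)) (η / 2)
    (ENNReal.half_pos hη.ne')
  filter_upwards [h] with n hn
  calc P {ω | δ ≤ dist (f n ω * e n ω) 0} ≤
        P ({ω | M < |f n ω|} ∪ {ω | δ / M ≤ dist (e n ω) 0}) := by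
        refine measure_mono fun ω hω => ?_
        by_contra hc
        simp only [Set.mem_union, Set.mem_ofPred_eq, not_or, not_lt, not_le, dist_zero_right,
          norm_mul, Real.norm_eq_abs] at hc hω
        rw [lt_div_iff₀ hM0] at hc
        nlinarith [abs_nonneg (e n ω), abs_nonneg (f n ω), mul_le_mul_of_nonneg_right hc.1
          (abs_nonneg (e n ω))]
    _ ≤ η / 2 + η / 2 := (measure_union_le _ _).trans (add_le_add (hM n) hn)
    _ = η := ENNReal.add_halves η

lemma tendstoInMeasure_prodMk_const {E F : Type*} [PseudoMetricSpace E] [PseudoMetricSpace F]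
    {f : ℕ → Ω → E} {g : ℕ → Ω → F} {c : E} {d : F}
    (hf : TendstoInMeasure P f atTop (fun _ => c)) (hg : TendstoInMeasure P g atTop (fun _ => d)) :
    TendstoInMeasure P (fun n ω => (f n ω, g n ω)) atTop (fun _ => (c, d)) := by
  rw [tendstoInMeasure_iff_dist] at hf hg ⊢
  intro ε hε
  have h := (hf ε hε).add (hg ε hε)
  rw [add_zero] at h
  refine tendsto_of_tendsto_of_tendsto_of_le_of_le tendsto_const_nhds h
    (fun _ => zero_le) fun n => (measure_mono fun ω hω => ?_).trans (measure_union_le _ _)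
  simpa [Prod.dist_eq] using hω

lemma tendstoInMeasure_of_tendsto {a : ℕ → ℝ} {c : ℝ} (ha : Tendsto a atTop (𝓝 c)) :
    TendstoInMeasure P (fun n _ => a n) atTop (fun _ => c) := by
  rw [tendstoInMeasure_iff_dist]
  intro ε hε
  refine tendsto_const_nhds.congr' ?_
  filter_upwards [Metric.tendsto_nhds.1 ha ε hε] with n hn
  simp [not_le.2 hn]

lemma tendstoInMeasure_add_zero_zero {f g : ℕ → Ω → ℝ}
    (hf : TendstoInMeasure P f atTop (fun _ => 0)) (hg : TendstoInMeasure P g atTop (fun _ => 0)) :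
    TendstoInMeasure P (fun n ω => f n ω + g n ω) atTop (fun _ => 0) := by
  have h := tendstoInMeasure_comp_continuousAt (tendstoInMeasure_prodMk_const hf hg)
    (g := fun p : ℝ × ℝ => p.1 + p.2) (by fun_prop)
  simpa using h

lemma tendstoInMeasure_const_mul_zero {f : ℕ → Ω → ℝ}
    (hf : TendstoInMeasure P f atTop (fun _ => 0)) (c : ℝ) :
    TendstoInMeasure P (fun n ω => c * f n ω) atTop (fun _ => 0) := by
  have h := tendstoInMeasure_comp_continuousAt hf (g := fun p : ℝ => c * p) (by fun_prop)
  simpa using h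

lemma tendstoInMeasure_pi_zero {ι : Type*} [Fintype ι] {f : ℕ → Ω → ι → ℝ}
    (hf : ∀ i, TendstoInMeasure P (fun n ω => f n ω i) atTop (fun _ => 0)) :
    TendstoInMeasure P f atTop 0 := by
  rw [tendstoInMeasure_iff_norm]
  intro ε hε
  have h : Tendsto (fun n => ∑ i, P {ω | ε ≤ dist (f n ω i) 0}) atTop (𝓝 0) := by
    have := tendsto_finsetSum Finset.univ fun i _ => (tendstoInMeasure_iff_dist.1 (hf i)) ε hε
    simpa using this
  refine tendsto_of_tendsto_of_tendsto_of_le_of_le tendsto_const_nhds h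
    (fun _ => zero_le) fun n => (measure_mono fun ω hω => ?_).trans (measure_iUnion_fintype_le _ _)
  by_contra hc
  simp only [Set.mem_iUnion, Set.mem_ofPred_eq, not_exists, not_le, dist_zero_right] at hc
  have := (pi_norm_lt_iff hε).2 hc
  simp only [Pi.zero_apply, sub_zero, Set.mem_ofPred_eq] at hω
  exact absurd hω (not_le.2 this)

/-- Two sequences which agree on events of probability tending to one have the same limit in
probability. -/
lemma tendstoInMeasure_of_agree {E : Type*} [PseudoMetricSpace E] {f g : ℕ → Ω → E} {c : Ω → E}
    {s : ℕ → Set Ω} (hs : Tendsto (fun n => P (s n)ᶜ) atTop (𝓝 0))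
    (hfg : ∀ᶠ n in atTop, ∀ᵐ ω ∂P, ω ∈ s n → f n ω = g n ω)
    (hg : TendstoInMeasure P g atTop c) : TendstoInMeasure P f atTop c := by
  rw [tendstoInMeasure_iff_dist] at hg ⊢
  intro ε hε
  have h := (hg ε hε).add hs
  rw [add_zero] at h
  refine tendsto_of_tendsto_of_tendsto_of_le_of_le' tendsto_const_nhds h
    (Eventually.of_forall fun _ => zero_le) ?_
  filter_upwards [hfg] with n hn
  refine (measure_mono_ae ?_).trans (measure_union_le _ _)
  filter_upwards [hn] with ω hω hle
  by_cases hmem : ω ∈ s n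
  · left
    have hle' : ε ≤ dist (f n ω) (c ω) := hle
    rw [hω hmem] at hle'
    exact hle'
  · right; exact hmem

/-- A convergent sequence of laws together with its limit is compact, hence tight by the converse
half of Prokhorov's theorem. -/
lemma boundedInProb_of_tendstoInDistribution {Ω' E : Type*} [MeasurableSpace Ω'] {P' : Measure Ω'}
    [IsProbabilityMeasure P] [IsProbabilityMeasure P'] [NormedAddCommGroup E] [CompleteSpace E]
    [SecondCountableTopology E] [MeasurableSpace E] [BorelSpace E] {X : ℕ → Ω → E} {Z : Ω' → E}
    (h : TendstoInDistribution X atTop Z (fun _ => P) P') :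
    BoundedInProb P (fun n ω => ‖X n ω‖) := by
  have hc := h.tendsto.isCompact_insert_range
  have ht := isTightMeasureSet_of_isCompact_closure (by rwa [hc.isClosed.closure_eq])
  rw [isTightMeasureSet_iff_exists_isCompact_measure_compl_le] at ht
  intro η hη
  obtain ⟨K, hK, hKη⟩ := ht η hη
  obtain ⟨M, hM⟩ := hK.isBounded.exists_norm_le
  refine ⟨M, fun n => ?_⟩
  have h1 := hKη _ ⟨_, Set.mem_insert_of_mem _ ⟨n, rfl⟩, rfl⟩
  rw [ProbabilityMeasure.coe_mk, Measure.map_apply_of_aemeasurable (h.forall_aemeasurable n)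
    hK.measurableSet.compl] at h1
  refine (measure_mono fun ω hω hmem => ?_).trans h1
  have hω' : M < |‖X n ω‖| := hω
  rw [abs_norm] at hω'
  exact absurd (hM _ hmem) (not_le.2 hω')

lemma tendstoInMeasure_inv_sqrt_smul {E : Type*} [NormedAddCommGroup E] [NormedSpace ℝ E]
    {T : ℕ → Ω → E} (hT : BoundedInProb P (fun n ω => ‖T n ω‖)) :
    TendstoInMeasure P (fun (n : ℕ) ω => (√n)⁻¹ • T n ω) atTop (fun _ => 0) := by
  have h := hT.mul_tendstoInMeasure (tendstoInMeasure_of_tendsto tendsto_inv_sqrt_natCast)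
  rw [tendstoInMeasure_iff_dist] at h ⊢
  simpa [norm_smul, mul_comm] using h

/-- The delta method, for a function differentiable at a point. -/
lemma tendstoInMeasure_delta {E : Type*} [NormedAddCommGroup E] [NormedSpace ℝ E] {g : E → ℝ}
    {g' : E →L[ℝ] ℝ} {v : E} (hg : HasFDerivAt g g' v) {T : ℕ → Ω → E}
    (hT : BoundedInProb P (fun n ω => ‖T n ω‖)) :
    TendstoInMeasure P
      (fun (n : ℕ) ω => √n * (g (v + (√n)⁻¹ • T n ω) - g v) - g' (T n ω)) atTop (fun _ => 0) := by
  -- The relative Taylor remainder, equal to `0` at the origin by the convention `0⁻¹ = 0`.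
  -- Differentiability makes it continuous there, and the quantity to bound is `‖T‖ * r ((√n)⁻¹ •
  -- T)`.
  set r : E → ℝ := fun y => ‖y‖⁻¹ * (g (v + y) - g v - g' y) with hr
  have hr0 : ContinuousAt r 0 := by
    have h := (hasFDerivAt_iff_isLittleO_nhds_zero.1 hg).norm_right.tendsto_inv_smul_nhds_zero
    rw [ContinuousAt, show r 0 = 0 by simp [hr]]
    simpa [hr] using h
  have hrz := tendstoInMeasure_comp_continuousAt (tendstoInMeasure_inv_sqrt_smul hT) hr0
  have h0 : r 0 = 0 := by simp [hr]
  rw [h0] at hrz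
  refine (hT.mul_tendstoInMeasure hrz).congr' ?_ EventuallyEq.rfl
  filter_upwards [eventually_gt_atTop 0] with n hn
  refine ae_of_all _ fun ω => ?_
  have hn' : 0 < √(n : ℝ) := sqrt_pos.2 (by exact_mod_cast hn)
  rcases eq_or_ne (T n ω) 0 with h | h
  · simp [h]
  · have hne : ‖T n ω‖ ≠ 0 := norm_ne_zero_iff.2 h
    simp only [hr, norm_smul, map_smul, smul_eq_mul, norm_inv, norm_of_nonneg hn'.le]
    field_simp

end Prob

/-! ### Uniqueness of the maximum likelihood estimate -/

lemma log_density {α β δ μ υ x y : ℝ} (hα : 0 < α) (hβ : 0 < β) (hυ : 0 < υ) (hx : 0 < x) :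
    log (density α β δ μ υ x y) =
      -log √(2 * π) + (α * log β - log (Gamma α)) - log υ / 2 + (α - 3 / 2) * log x - β * x -
        (y - δ - μ * x) ^ 2 / x / (2 * υ) := by
  have hG := Gamma_pos_of_pos hα
  have h1 : √(2 * π) ≠ 0 := by positivity
  have h2 : √υ ≠ 0 := by positivity
  have h3 : β ^ α ≠ 0 := by positivity
  have h4 : x ^ (α - 3 / 2) ≠ 0 := by positivity
  rw [density, if_pos hx, log_mul (by positivity) (exp_pos _).ne', log_exp,
    log_mul (by positivity) h4, log_mul (by positivity) (by positivity),
    log_mul (by positivity) (by positivity), log_div h3 hG.ne', one_div, one_div, log_inv, log_inv,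
    log_rpow hβ, log_rpow hx, log_sqrt hυ.le]
  field_simp
  ring

/-- Apart from a term free of `θ`, the two parenthesized groups involve disjoint sets of parameters,
so they can be maximized separately. -/
lemma logLikelihood_eq {n : ℕ} {x y : ℕ → ℝ} (hx : ∀ i < n, 0 < x i) {θ : Fin 5 → ℝ}
    (hθ : θ ∈ paramSpace) :
    logLikelihood n x y θ = -n * log √(2 * π) - 3 / 2 * ∑ i ∈ Finset.range n, log (x i) +
      (n * (θ 0 * log (θ 1) - log (Gamma (θ 0))) + θ 0 * ∑ i ∈ Finset.range n, log (x i) -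
        θ 1 * ∑ i ∈ Finset.range n, x i) +
      (-(n * (log (θ 4) / 2)) -
        (∑ i ∈ Finset.range n, (y i - θ 2 - θ 3 * x i) ^ 2 / x i) / (2 * θ 4)) := by
  obtain ⟨h0, h1, h4⟩ := hθ
  rw [logLikelihood, Finset.sum_congr rfl fun i hi =>
    log_density h0 h1 h4 (hx i (Finset.mem_range.1 hi))]
  simp only [Finset.sum_sub_distrib, Finset.sum_add_distrib, Finset.sum_const, Finset.card_range,
    ← Finset.mul_sum, ← Finset.sum_div, nsmul_eq_mul]
  ring

lemma strictAntiOn_log_sub_digamma :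
    StrictAntiOn (fun α => log α - digamma α) (Set.Ioi 0) := by
  have hd (α : ℝ) (hα : 0 < α) :
      HasDerivAt (fun α => log α - digamma α) (α⁻¹ - deriv digamma α) α :=
    (hasDerivAt_log hα.ne').sub (hasDerivAt_digamma hα)
  refine strictAntiOn_of_deriv_neg (convex_Ioi 0)
    (fun α hα => (hd α hα).continuousAt.continuousWithinAt) fun α hα => ?_
  rw [interior_Ioi] at hα
  rw [(hd α hα).deriv]
  linarith [inv_lt_deriv_digamma hα]

/-- The profile likelihood of the shape parameter is maximal exactly at the root of the likelihood
equation. -/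
lemma profile_shape_lt {a c α : ℝ} (ha : 0 < a) (hα : 0 < α) (hne : α ≠ a)
    (hac : log a - digamma a = c) :
    α * log α - α - log (Gamma α) - α * c < a * log a - a - log (Gamma a) - a * c := by
  have hd (t : ℝ) (ht : 0 < t) :
      HasDerivAt (fun t => t * log t - t - log (Gamma t) - t * c) (log t - digamma t - c) t := by
    have := ((((hasDerivAt_id t).mul (hasDerivAt_log ht.ne')).sub (hasDerivAt_id t)).sub
      (hasDerivAt_log_Gamma ht)).sub ((hasDerivAt_id t).mul_const c)
    refine this.congr_deriv ?_
    simp only [id_eq]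
    field_simp
    ring
  rcases lt_or_gt_of_ne hne with h | h
  · refine strictMonoOn_of_deriv_pos (convex_Icc α a) (fun t ht =>
      (hd t (hα.trans_le ht.1)).continuousAt.continuousWithinAt) (fun t ht => ?_)
      (Set.left_mem_Icc.2 h.le) (Set.right_mem_Icc.2 h.le) h
    rw [interior_Icc] at ht
    have ht0 := hα.trans ht.1
    rw [(hd t ht0).deriv]
    have : log a - digamma a < log t - digamma t := strictAntiOn_log_sub_digamma ht0 ha ht.2
    linarith
  · refine strictAntiOn_of_deriv_neg (convex_Icc a α) (fun t ht =>
      (hd t (ha.trans_le ht.1)).continuousAt.continuousWithinAt) (fun t ht => ?_)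
      (Set.left_mem_Icc.2 h.le) (Set.right_mem_Icc.2 h.le) h
    rw [interior_Icc] at ht
    have ht0 := ha.trans ht.1
    rw [(hd t ht0).deriv]
    have : log t - digamma t < log a - digamma a := strictAntiOn_log_sub_digamma ha ht0 ht.1
    linarith

/-- For fixed `α`, the inequality `log t ≤ t - 1` at `t = β * m / α` shows that `β = α / m` is the
only optimal rate; the remaining profile in `α` is handled by `profile_shape_lt`. -/
lemma gamma_part_le {a b m l α β : ℝ} (ha : 0 < a) (hm : 0 < m) (hb : b = a / m)
    (hac : log a - digamma a = log m - l) (hα : 0 < α) (hβ : 0 < β) :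
    α * log β - log (Gamma α) + α * l - β * m ≤ a * log b - log (Gamma a) + a * l - b * m ∧
    (α * log β - log (Gamma α) + α * l - β * m = a * log b - log (Gamma a) + a * l - b * m →
      α = a ∧ β = b) := by
  have hB : b * m = a := by rw [hb]; field_simp
  have hlb : log b = log a - log m := by rw [hb, log_div ha.ne' hm.ne']
  have hrhs : a * log b - log (Gamma a) + a * l - b * m =
      a * log a - a - log (Gamma a) - a * (log m - l) := by rw [hB, hlb]; ring
  have ht : 0 < β * m / α := by positivity
  have hlog : log (β * m / α) = log β + log m - log α := by
    rw [log_div (by positivity) hα.ne', log_mul hβ.ne' hm.ne']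
  have h1 : α * log (β * m / α) ≤ β * m - α := by
    have := mul_le_mul_of_nonneg_left (log_le_sub_one_of_pos ht) hα.le
    have e : α * (β * m / α - 1) = β * m - α := by field_simp
    linarith
  rw [hlog] at h1
  rw [hrhs]
  have h2 : α * log β - log (Gamma α) + α * l - β * m ≤
      α * log α - α - log (Gamma α) - α * (log m - l) := by linarith
  rcases eq_or_ne α a with rfl | hne
  · refine ⟨h2, fun heq => ⟨rfl, ?_⟩⟩
    by_contra hne
    have hne1 : β * m / α ≠ 1 := by
      intro h
      rw [div_eq_one_iff_eq hα.ne'] at h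
      apply hne
      rw [hb, ← h]; field_simp
    have h3 := mul_lt_mul_of_pos_left (log_lt_sub_one_of_pos ht hne1) hα
    have e : α * (β * m / α - 1) = β * m - α := by field_simp
    rw [hlog, e] at h3
    linarith
  · have h3 := profile_shape_lt ha hα hne hac
    exact ⟨by linarith, fun heq => by linarith⟩

/-- Shrinking the residual sum to its minimum `s` helps for every `υ`; then `log t ≤ t - 1` at `t =
v / υ` singles out `υ = v`. -/
lemma normal_part_le {N s S v υ : ℝ} (hN : 0 < N) (hv : 0 < v) (hs : s = N * v) (hS : s ≤ S)
    (hυ : 0 < υ) :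
    -(N * (log υ / 2)) - S / (2 * υ) ≤ -(N * (log v / 2)) - s / (2 * v) ∧
    (-(N * (log υ / 2)) - S / (2 * υ) = -(N * (log v / 2)) - s / (2 * v) → S = s ∧ υ = v) := by
  have e1 : s / (2 * v) = N / 2 := by rw [hs]; field_simp
  have ht : 0 < v / υ := by positivity
  have hlog : log (v / υ) = log v - log υ := log_div hv.ne' hυ.ne'
  have e2 : s / (2 * υ) = N / 2 * (v / υ) := by rw [hs]; field_simp
  have h1 : s / (2 * υ) ≤ S / (2 * υ) := by gcongr
  have h2 := mul_le_mul_of_nonneg_left (log_le_sub_one_of_pos ht) (by positivity : 0 ≤ N / 2)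
  rw [hlog] at h2
  rw [e1]
  refine ⟨by linarith, fun heq => ?_⟩
  have hυv : υ = v := by
    by_contra hne
    have hne1 : v / υ ≠ 1 := fun h => hne ((div_eq_one_iff_eq hυ.ne').1 h).symm
    have h3 := mul_lt_mul_of_pos_left (log_lt_sub_one_of_pos ht hne1) (by positivity : 0 < N / 2)
    rw [hlog] at h3
    linarith
  refine ⟨?_, hυv⟩
  subst hυv
  have h3 : S / (2 * υ) = s / (2 * υ) := by linarith
  exact (div_left_inj' (by positivity)).1 h3

/-- Pythagoras in the inner product with weights `1 / x i`: the normal equations annihilate the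
cross terms. -/
lemma weighted_residual_eq {n : ℕ} {x y : ℕ → ℝ} (hx : ∀ i < n, 0 < x i) {d m d' m' : ℝ}
    (h1 : ∑ i ∈ Finset.range n, (y i - d - m * x i) / x i = 0)
    (h2 : ∑ i ∈ Finset.range n, (y i - d - m * x i) = 0) :
    ∑ i ∈ Finset.range n, (y i - d' - m' * x i) ^ 2 / x i =
      ∑ i ∈ Finset.range n, (y i - d - m * x i) ^ 2 / x i +
      ((d' - d) ^ 2 * ∑ i ∈ Finset.range n, (x i)⁻¹ + 2 * (d' - d) * (m' - m) * n +
        (m' - m) ^ 2 * ∑ i ∈ Finset.range n, x i) := by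
  have e : ∀ i ∈ Finset.range n, (y i - d' - m' * x i) ^ 2 / x i =
      (y i - d - m * x i) ^ 2 / x i - 2 * (d' - d) * ((y i - d - m * x i) / x i) -
        2 * (m' - m) * (y i - d - m * x i) +
        ((d' - d) ^ 2 * (x i)⁻¹ + 2 * (d' - d) * (m' - m) + (m' - m) ^ 2 * x i) := by
    intro i hi
    have := (hx i (Finset.mem_range.1 hi)).ne'
    field_simp
    ring
  rw [Finset.sum_congr rfl e]
  simp only [Finset.sum_add_distrib, Finset.sum_sub_distrib, ← Finset.mul_sum, h1, h2,
    Finset.sum_const, Finset.card_range, nsmul_eq_mul]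
  ring

/-- If the likelihood equations have a solution and the observations are not degenerate, then the
solution is the unique maximum likelihood estimate. -/
lemma isMLE_and_unique {n : ℕ} (hn : 0 < n) {x y : ℕ → ℝ} (hx : ∀ i < n, 0 < x i)
    {θ : Fin 5 → ℝ} (h0 : 0 < θ 0)
    (hshape : log (θ 0) - digamma (θ 0) = log ((∑ i ∈ Finset.range n, x i) / n) -
      (∑ i ∈ Finset.range n, log (x i)) / n)
    (hrate : θ 1 = θ 0 / ((∑ i ∈ Finset.range n, x i) / n))
    (hnormal₁ : ∑ i ∈ Finset.range n, (y i - θ 2 - θ 3 * x i) / x i = 0)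
    (hnormal₂ : ∑ i ∈ Finset.range n, (y i - θ 2 - θ 3 * x i) = 0)
    (hdet : (n : ℝ) ^ 2 < (∑ i ∈ Finset.range n, (x i)⁻¹) * ∑ i ∈ Finset.range n, x i)
    (hυ : ∑ i ∈ Finset.range n, (y i - θ 2 - θ 3 * x i) ^ 2 / x i = n * θ 4) (h4 : 0 < θ 4) :
    IsMLE n x y θ ∧ ∀ θ', IsMLE n x y θ' → θ' = θ := by
  have hn' : (0 : ℝ) < n := by exact_mod_cast hn
  have hne : (Finset.range n).Nonempty := ⟨0, Finset.mem_range.2 hn⟩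
  have hSx : 0 < ∑ i ∈ Finset.range n, x i :=
    Finset.sum_pos (fun i hi => hx i (Finset.mem_range.1 hi)) hne
  have hSr : 0 < ∑ i ∈ Finset.range n, (x i)⁻¹ :=
    Finset.sum_pos (fun i hi => inv_pos.2 (hx i (Finset.mem_range.1 hi))) hne
  set Sx := ∑ i ∈ Finset.range n, x i with hSxdef
  set Sr := ∑ i ∈ Finset.range n, (x i)⁻¹ with hSrdef
  set Sl := ∑ i ∈ Finset.range n, log (x i) with hSldef
  have h1 : 0 < θ 1 := by rw [hrate]; positivity
  have hmem : θ ∈ paramSpace := ⟨h0, h1, h4⟩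
  have key : ∀ θ' ∈ paramSpace, logLikelihood n x y θ' ≤ logLikelihood n x y θ ∧
      (logLikelihood n x y θ' = logLikelihood n x y θ → θ' = θ) := by
    intro θ' hθ'
    have hθ'' := hθ'
    obtain ⟨k0, k1, k4⟩ := hθ''
    have hw := weighted_residual_eq hx (d' := θ' 2) (m' := θ' 3) hnormal₁ hnormal₂
    rw [← hSxdef, ← hSrdef] at hw
    -- Completing the square. The excess residual is positive definite because the strict
    -- Cauchy–Schwarz inequality `hdet` makes the second coefficient positive.
    have hquad : Sr * ((θ' 2 - θ 2) ^ 2 * Sr + 2 * (θ' 2 - θ 2) * (θ' 3 - θ 3) * n +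
        (θ' 3 - θ 3) ^ 2 * Sx) = (Sr * (θ' 2 - θ 2) + n * (θ' 3 - θ 3)) ^ 2 +
        (Sr * Sx - n ^ 2) * (θ' 3 - θ 3) ^ 2 := by ring
    have hdet' : 0 < Sr * Sx - n ^ 2 := by linarith
    have hq0 : 0 ≤ (θ' 2 - θ 2) ^ 2 * Sr + 2 * (θ' 2 - θ 2) * (θ' 3 - θ 3) * n +
        (θ' 3 - θ 3) ^ 2 * Sx := by
      refine nonneg_of_mul_nonneg_right (a := Sr) ?_ hSr
      rw [hquad]; positivity
    obtain ⟨g1, g2⟩ := gamma_part_le (l := Sl / n) h0 (by positivity) hrate hshape k0 k1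
    obtain ⟨n1, n2⟩ := normal_part_le (S := ∑ i ∈ Finset.range n, (y i - θ' 2 - θ' 3 * x i) ^ 2 / x i)
      hn' h4 hυ (by rw [hw]; linarith) k4
    have eg (a b c : ℝ) : n * (a * log b - c) + a * Sl - b * Sx =
        n * (a * log b - c + a * (Sl / n) - b * (Sx / n)) := by field_simp
    rw [logLikelihood_eq hx hθ', logLikelihood_eq hx hmem, ← hSxdef, ← hSldef, eg, eg]
    have g3 := mul_le_mul_of_nonneg_left g1 hn'.le
    refine ⟨by linarith, fun heq => ?_⟩
    have g4 : θ' 0 = θ 0 ∧ θ' 1 = θ 1 := g2 (mul_left_cancel₀ hn'.ne' (by linarith))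
    obtain ⟨n3, n4⟩ := n2 (by linarith)
    rw [hw] at n3
    have hq : (θ' 2 - θ 2) ^ 2 * Sr + 2 * (θ' 2 - θ 2) * (θ' 3 - θ 3) * n +
        (θ' 3 - θ 3) ^ 2 * Sx = 0 := by linarith
    rw [hq, mul_zero] at hquad
    obtain ⟨q1, q2⟩ := (add_eq_zero_iff_of_nonneg (sq_nonneg _)
      (mul_nonneg hdet'.le (sq_nonneg _))).1 hquad.symm
    have z2 : θ' 3 - θ 3 = 0 :=
      (pow_eq_zero_iff two_ne_zero).1 ((mul_eq_zero.1 q2).resolve_left hdet'.ne')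
    have z3 : θ' 2 - θ 2 = 0 := by
      have q3 := (pow_eq_zero_iff two_ne_zero).1 q1
      rw [z2, mul_zero, add_zero] at q3
      exact (mul_eq_zero.1 q3).resolve_left hSr.ne'
    ext j
    fin_cases j
    · exact g4.1
    · exact g4.2
    · exact sub_eq_zero.1 z3
    · exact sub_eq_zero.1 z2
    · exact n4
  refine ⟨⟨hmem, fun θ' hθ' => (key θ' hθ').1⟩, fun θ' hθ' => ?_⟩
  exact (key θ' hθ'.1).2 (le_antisymm (key θ' hθ'.1).1 (hθ'.2 hmem))

/-! ### The solution of the likelihood equations -/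

/-- The inverse function theorem at `α = 1`, where `log - ψ` has value `-ψ(1)` and derivative `1 -
ψ'(1) < 0`. A local inverse suffices because the argument concentrates at `-ψ(1)`. -/
lemma exists_inverse_log_sub_digamma :
    ∃ k : ℝ → ℝ, k (-digamma 1) = 1 ∧ HasDerivAt k (1 - deriv digamma 1)⁻¹ (-digamma 1) ∧
      ∀ᶠ c in 𝓝 (-digamma 1), 0 < k c ∧ log (k c) - digamma (k c) = c := by
  have h1 := inv_lt_deriv_digamma one_pos
  rw [inv_one] at h1
  have hs : HasStrictDerivAt (fun α => log α - digamma α) (1 - deriv digamma 1) 1 := by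
    have h2 := (hasStrictDerivAt_log (one_ne_zero (α := ℝ)))
    have h3 := (analyticAt_digamma one_pos).hasStrictDerivAt
    rw [inv_one] at h2
    exact h2.sub h3
  have hne : 1 - deriv digamma 1 ≠ 0 := by linarith
  have hval : log (1 : ℝ) - digamma 1 = -digamma 1 := by simp
  have hinv := hs.to_localInverse hne
  have hk1 : hs.localInverse _ _ _ hne (-digamma 1) = 1 := by
    have := HasStrictFDerivAt.localInverse_apply_image (hs.hasStrictFDerivAt_equiv hne)
    simpa [HasStrictDerivAt.localInverse] using this
  rw [hval] at hinv
  refine ⟨hs.localInverse _ _ _ hne, hk1, hinv.hasDerivAt, ?_⟩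
  have hr := HasStrictFDerivAt.eventually_right_inverse (hs.hasStrictFDerivAt_equiv hne)
  rw [hval] at hr
  have hpos : ∀ᶠ c in 𝓝 (-digamma 1), 0 < hs.localInverse _ _ _ hne c :=
    hinv.hasDerivAt.continuousAt.eventually_const_lt (by rw [hk1]; exact one_pos)
  filter_upwards [hr, hpos] with c hc1 hc2
  exact ⟨hc2, hc1⟩

/-- The normalized fluctuations of the sample means of `X` and of `ln X`, expressed through the sum
of the influence functions. -/
noncomputable def meanFluctuation (β : ℝ) (J : Fin 5 → ℝ) : ℝ × ℝ :=
  ((β * J 0 - J 1) / β ^ 2, (deriv digamma 1 - 1) * J 0 + β * ((β * J 0 - J 1) / β ^ 2))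

/-- The sample means of `X` and of `ln X`. -/
noncomputable def sampleMeans (β : ℝ) (n : ℕ) (J : Fin 5 → ℝ) : ℝ × ℝ :=
  (1 / β, digamma 1 - log β) + (√n)⁻¹ • meanFluctuation β J

/-- The determinant of the normalized normal equations. -/
noncomputable def regDet (β : ℝ) (n : ℕ) (J : Fin 5 → ℝ) (R : ℝ) : ℝ :=
  R * (sampleMeans β n J).1 - (log n)⁻¹

/-- The normalized error of the weighted least squares estimate of the intercept. -/
noncomputable def interceptError (β : ℝ) (n : ℕ) (J : Fin 5 → ℝ) (R : ℝ) : ℝ :=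
  ((sampleMeans β n J).1 * (β * J 2) - J 3 / β * (√(log n))⁻¹) / regDet β n J R

/-- The normalized error of the weighted least squares estimate of the slope. -/
noncomputable def slopeError (β : ℝ) (n : ℕ) (J : Fin 5 → ℝ) (R : ℝ) : ℝ :=
  (R * (J 3 / β) - β * J 2 * (√(log n))⁻¹) / regDet β n J R

/-- The solution of the likelihood equations, where `k` is a local inverse of `ln - ψ`. -/
noncomputable def likelihoodRoot (k : ℝ → ℝ) (β δ μ σ : ℝ) (n : ℕ) (J : Fin 5 → ℝ) (R : ℝ) :
    Fin 5 → ℝ :=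
  ![k (log (sampleMeans β n J).1 - (sampleMeans β n J).2),
    k (log (sampleMeans β n J).1 - (sampleMeans β n J).2) / (sampleMeans β n J).1,
    δ + (√(n * log n))⁻¹ * interceptError β n J R,
    μ + (√n)⁻¹ * slopeError β n J R,
    σ ^ 2 + (√n)⁻¹ * J 4 -
      (interceptError β n J R * (β * J 2) + slopeError β n J R * (J 3 / β)) / n]

/-- The coordinates of `J` are invertible affine functions of the five sums occurring in the
likelihood equations, so only `∑ 1 / X_i` has to be tracked separately, through `R`. -/
lemma sums_eq_of_influence {β σ : ℝ} (hβ : 0 < β) {n : ℕ} (hn : 1 < n) {v : ℕ → ℝ × ℝ}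
    {J : Fin 5 → ℝ} (hJ : J = ∑ i ∈ Finset.range n, influence β σ n (v i)) :
    (∑ i ∈ Finset.range n, (v i).1) / n = (sampleMeans β n J).1 ∧
    (∑ i ∈ Finset.range n, log (v i).1) / n = (sampleMeans β n J).2 ∧
    ∑ i ∈ Finset.range n, σ * ((v i).2 / √(v i).1) = √(n * log n) * (β * J 2) ∧
    ∑ i ∈ Finset.range n, σ * (√(v i).1 * (v i).2) = √n * (J 3 / β) ∧
    ∑ i ∈ Finset.range n, σ ^ 2 * (v i).2 ^ 2 = n * σ ^ 2 + √n * J 4 := by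
  have hn0 : (0 : ℝ) < n := by exact_mod_cast (zero_lt_one.trans hn)
  have hlog : 0 < log (n : ℝ) := log_pos (by exact_mod_cast hn)
  have hs : 0 < √(n : ℝ) := sqrt_pos.2 hn0
  have hnl : 0 < √(n * log n : ℝ) := by positivity
  have hss : √(n : ℝ) * √(n : ℝ) = n := mul_self_sqrt hn0.le
  have hD := inv_lt_deriv_digamma one_pos
  rw [inv_one] at hD
  have hD0 : deriv digamma 1 - 1 ≠ 0 := by linarith
  set D := deriv digamma 1 - 1 with hDdef
  set m := digamma 1 - log β with hm
  have J0 : J 0 = (√n)⁻¹ * (D⁻¹ * (∑ i ∈ Finset.range n, log (v i).1 - n * m -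
      β * (∑ i ∈ Finset.range n, (v i).1 - n * (1 / β)))) := by
    rw [hJ]
    simp only [influence, Finset.sum_apply, cons_val, ← Finset.mul_sum, Finset.sum_sub_distrib,
      Finset.sum_const, Finset.card_range, nsmul_eq_mul]
    rw [hm]; ring
  have J1 : J 1 = (√n)⁻¹ * (β * (D⁻¹ * (∑ i ∈ Finset.range n, log (v i).1 - n * m -
      β * (∑ i ∈ Finset.range n, (v i).1 - n * (1 / β)))) -
      β ^ 2 * (∑ i ∈ Finset.range n, (v i).1 - n * (1 / β))) := by
    rw [hJ]
    simp only [influence, Finset.sum_apply, cons_val, ← Finset.mul_sum, Finset.sum_sub_distrib,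
      Finset.sum_const, Finset.card_range, nsmul_eq_mul]
    rw [hm]; ring
  have J2 : J 2 = (√(n * log n))⁻¹ * (β⁻¹ * ∑ i ∈ Finset.range n, σ * ((v i).2 / √(v i).1)) := by
    rw [hJ]
    simp only [influence, Finset.sum_apply, cons_val, Finset.mul_sum]
    exact Finset.sum_congr rfl fun i _ => by ring
  have J3 : J 3 = (√n)⁻¹ * (β * ∑ i ∈ Finset.range n, σ * (√(v i).1 * (v i).2)) := by
    rw [hJ]
    simp only [influence, Finset.sum_apply, cons_val, Finset.mul_sum]
    exact Finset.sum_congr rfl fun i _ => by ring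
  have J4 : J 4 = (√n)⁻¹ * (∑ i ∈ Finset.range n, σ ^ 2 * (v i).2 ^ 2 - n * σ ^ 2) := by
    rw [hJ]
    simp only [influence, Finset.sum_apply, cons_val, ← Finset.mul_sum, Finset.sum_sub_distrib,
      Finset.sum_const, Finset.card_range, nsmul_eq_mul]
    ring
  -- In `β * J 0 - J 1` the logarithmic parts cancel, leaving `β ^ 2` times the fluctuation of the
  -- mean of `X`.
  have hA : (β * J 0 - J 1) / β ^ 2 = (√n)⁻¹ * (∑ i ∈ Finset.range n, (v i).1 - n * (1 / β)) := by
    rw [J0, J1]; field_simp; ring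
  have hB : D * J 0 + β * ((β * J 0 - J 1) / β ^ 2) =
      (√n)⁻¹ * (∑ i ∈ Finset.range n, log (v i).1 - n * m) := by
    rw [hA, J0]; field_simp; ring
  have hsc (a : ℝ) : (√(n : ℝ))⁻¹ * ((√(n : ℝ))⁻¹ * a) = a / n := by
    rw [← mul_assoc, ← mul_inv, hss, div_eq_inv_mul]
  refine ⟨?_, ?_, ?_, ?_, ?_⟩
  · simp only [sampleMeans, meanFluctuation, Prod.fst_add, Prod.smul_fst, smul_eq_mul]
    rw [hA, hsc]; field_simp; ring
  · simp only [sampleMeans, meanFluctuation, Prod.snd_add, Prod.smul_snd, smul_eq_mul]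
    rw [← hDdef, hB, hsc]; field_simp; ring
  · rw [J2]; field_simp
  · rw [J3]; field_simp
  · rw [J4]; field_simp; ring

/-- Cramer's rule for `d * R + m / t = C`, `d / t + m * xb = D`, with `s = √n` and `t = √(log n)` in
the application. The off-diagonal entry `1 / t` tends to zero, so intercept and slope decouple in
the limit. -/
lemma normal_equations {s t R xb C D d m : ℝ} (hs : s ≠ 0) (ht : t ≠ 0)
    (hden : R * xb - (t ^ 2)⁻¹ ≠ 0) (hd : d = (xb * C - D * t⁻¹) / (R * xb - (t ^ 2)⁻¹))
    (hm : m = (R * D - C * t⁻¹) / (R * xb - (t ^ 2)⁻¹)) :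
    s * t * C - (s * t)⁻¹ * d * (s ^ 2 * t ^ 2 * R) - s⁻¹ * m * s ^ 2 = 0 ∧
      s * D - (s * t)⁻¹ * d * s ^ 2 - s⁻¹ * m * (s ^ 2 * xb) = 0 := by
  have hd' : d * (R * xb - (t ^ 2)⁻¹) = xb * C - D * t⁻¹ := by rw [hd, div_mul_cancel₀ _ hden]
  have hm' : m * (R * xb - (t ^ 2)⁻¹) = R * D - C * t⁻¹ := by rw [hm, div_mul_cancel₀ _ hden]
  have e1 : C - d * R - m * t⁻¹ = 0 := by
    refine (mul_eq_zero.1 ?_).resolve_right hden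
    have : (C - d * R - m * t⁻¹) * (R * xb - (t ^ 2)⁻¹) = C * (R * xb - (t ^ 2)⁻¹) -
      d * (R * xb - (t ^ 2)⁻¹) * R - m * (R * xb - (t ^ 2)⁻¹) * t⁻¹ := by ring
    rw [this, hd', hm']; ring
  have e2 : D - d * t⁻¹ - m * xb = 0 := by
    refine (mul_eq_zero.1 ?_).resolve_right hden
    have : (D - d * t⁻¹ - m * xb) * (R * xb - (t ^ 2)⁻¹) = D * (R * xb - (t ^ 2)⁻¹) -
      d * (R * xb - (t ^ 2)⁻¹) * t⁻¹ - m * (R * xb - (t ^ 2)⁻¹) * xb := by ring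
    rw [this, hd', hm']; ring
  constructor
  · have : s * t * C - (s * t)⁻¹ * d * (s ^ 2 * t ^ 2 * R) - s⁻¹ * m * s ^ 2 =
        s * t * (C - d * R - m * t⁻¹) := by field_simp
    rw [this, e1, mul_zero]
  · have : s * D - (s * t)⁻¹ * d * s ^ 2 - s⁻¹ * m * (s ^ 2 * xb) =
        s * (D - d * t⁻¹ - m * xb) := by field_simp
    rw [this, e2, mul_zero]

lemma isMLE_likelihoodRoot {k : ℝ → ℝ} {β δ μ σ : ℝ} (hβ : 0 < β) {n : ℕ}
    (hn : 1 < n) {v : ℕ → ℝ × ℝ} (hv : ∀ i, 0 < (v i).1) {y : ℕ → ℝ}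
    (hy : ∀ i, y i = δ + μ * (v i).1 + σ * √(v i).1 * (v i).2) {J : Fin 5 → ℝ} {R : ℝ}
    (hJ : J = ∑ i ∈ Finset.range n, influence β σ n (v i))
    (hR : R = ((n : ℝ) * log n)⁻¹ * ∑ i ∈ Finset.range n, ((v i).1)⁻¹)
    (hk : 0 < k (log (sampleMeans β n J).1 - (sampleMeans β n J).2))
    (hk' : log (k (log (sampleMeans β n J).1 - (sampleMeans β n J).2)) -
      digamma (k (log (sampleMeans β n J).1 - (sampleMeans β n J).2)) =
      log (sampleMeans β n J).1 - (sampleMeans β n J).2)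
    (hdet : 0 < regDet β n J R) (hυ : 0 < likelihoodRoot k β δ μ σ n J R 4) :
    IsMLE n (fun i => (v i).1) y (likelihoodRoot k β δ μ σ n J R) ∧
      ∀ θ, IsMLE n (fun i => (v i).1) y θ → θ = likelihoodRoot k β δ μ σ n J R := by
  obtain ⟨s1, s2, s3, s4, s5⟩ := sums_eq_of_influence hβ hn hJ
  have hn0 : (0 : ℝ) < n := by exact_mod_cast (zero_lt_one.trans hn)
  have hlog : 0 < log (n : ℝ) := log_pos (by exact_mod_cast hn)
  have hs : √(n : ℝ) ≠ 0 := by positivity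
  have ht : √(log n : ℝ) ≠ 0 := by positivity
  have hs2 : √(n : ℝ) ^ 2 = n := sq_sqrt hn0.le
  have ht2 : √(log n : ℝ) ^ 2 = log n := sq_sqrt hlog.le
  have hst : √(n * log n : ℝ) = √n * √(log n) := sqrt_mul hn0.le _
  set θ := likelihoodRoot k β δ μ σ n J R with hθ
  have t0 : θ 0 = k (log (sampleMeans β n J).1 - (sampleMeans β n J).2) := rfl
  have t1 : θ 1 = k (log (sampleMeans β n J).1 - (sampleMeans β n J).2) / (sampleMeans β n J).1 :=
    rfl
  have t2 : θ 2 = δ + (√(n * log n))⁻¹ * interceptError β n J R := rfl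
  have t3 : θ 3 = μ + (√n)⁻¹ * slopeError β n J R := rfl
  have t4 : θ 4 = σ ^ 2 + (√n)⁻¹ * J 4 -
      (interceptError β n J R * (β * J 2) + slopeError β n J R * (J 3 / β)) / n := rfl
  set a := interceptError β n J R with ha
  set b := slopeError β n J R with hb
  have hSx : ∑ i ∈ Finset.range n, (v i).1 = n * (sampleMeans β n J).1 := by
    rw [← s1]; field_simp
  have hSr : ∑ i ∈ Finset.range n, ((v i).1)⁻¹ = n * log n * R := by
    rw [hR]; field_simp
  obtain ⟨e1, e2⟩ := normal_equations (s := √n) (t := √(log n)) (R := R)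
    (xb := (sampleMeans β n J).1) (C := β * J 2) (D := J 3 / β) (d := a) (m := b) hs ht
    (by rw [ht2]; exact hdet.ne') (by rw [ha, interceptError, ht2, regDet])
    (by rw [hb, slopeError, ht2, regDet])
  rw [hs2, ht2, ← hst, ← hSr] at e1
  rw [hs2, ← hst, ← hSx] at e2
  have r1 : ∑ i ∈ Finset.range n, (y i - θ 2 - θ 3 * (v i).1) / (v i).1 = 0 := by
    have h : ∀ i ∈ Finset.range n, (y i - θ 2 - θ 3 * (v i).1) / (v i).1 =
        σ * ((v i).2 / √(v i).1) - (√(n * log n))⁻¹ * a * ((v i).1)⁻¹ - (√n)⁻¹ * b := by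
      intro i _
      have hx := (hv i).ne'
      have hxs : √(v i).1 ≠ 0 := (sqrt_pos.2 (hv i)).ne'
      have hxx : √(v i).1 ^ 2 = (v i).1 := sq_sqrt (hv i).le
      have h3 : σ * ((v i).2 / √(v i).1) = σ * √(v i).1 * (v i).2 / (v i).1 := by
        nth_rewrite 3 [← hxx]
        field_simp
      rw [hy, t2, t3, h3]
      field_simp
      ring
    rw [Finset.sum_congr rfl h]
    simp only [Finset.sum_sub_distrib, ← Finset.mul_sum, Finset.sum_const, Finset.card_range,
      nsmul_eq_mul]
    rw [← e1, Finset.mul_sum, s3]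
    ring
  have r2 : ∑ i ∈ Finset.range n, (y i - θ 2 - θ 3 * (v i).1) = 0 := by
    have h : ∀ i ∈ Finset.range n, (y i - θ 2 - θ 3 * (v i).1) =
        σ * (√(v i).1 * (v i).2) - (√(n * log n))⁻¹ * a - (√n)⁻¹ * b * (v i).1 := by
      intro i _
      rw [hy, t2, t3]
      ring
    rw [Finset.sum_congr rfl h]
    simp only [Finset.sum_sub_distrib, ← Finset.mul_sum, Finset.sum_const, Finset.card_range,
      nsmul_eq_mul]
    rw [← e2, Finset.mul_sum, s4]
    ring
  -- Pythagoras is applied with the true `(δ, μ)` as competitor, since the residual sum there is a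
  -- function of the `Z i` alone.
  have hw := weighted_residual_eq (x := fun i => (v i).1) (fun i _ => hv i) (d' := δ) (m' := μ)
    r1 r2
  have hw0 : ∑ i ∈ Finset.range n, (y i - δ - μ * (v i).1) ^ 2 / (v i).1 =
      n * σ ^ 2 + √n * J 4 := by
    rw [← s5]
    refine Finset.sum_congr rfl fun i _ => ?_
    have hx := (hv i).ne'
    have hxx : √(v i).1 ^ 2 = (v i).1 := sq_sqrt (hv i).le
    rw [hy, show δ + μ * (v i).1 + σ * √(v i).1 * (v i).2 - δ - μ * (v i).1 =
      σ * √(v i).1 * (v i).2 by ring, mul_pow, mul_pow, hxx]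
    field_simp
  have r5 : ∑ i ∈ Finset.range n, (y i - θ 2 - θ 3 * (v i).1) ^ 2 / (v i).1 = n * θ 4 := by
    rw [hw0] at hw
    have q1 : δ - θ 2 = -((√(n * log n))⁻¹ * a) := by rw [t2]; ring
    have q2 : μ - θ 3 = -((√n)⁻¹ * b) := by rw [t3]; ring
    rw [q1, q2] at hw
    have hnl : √(n * log n : ℝ) ≠ 0 := by positivity
    have hC : a * (β * J 2) = (√(n * log n))⁻¹ * a * (√(n * log n) * (β * J 2)) := by
      field_simp
    have hD : b * (J 3 / β) = (√n)⁻¹ * b * (√n * (J 3 / β)) := by field_simp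
    have hnJ : n * (σ ^ 2 + (√(n : ℝ))⁻¹ * J 4) = n * σ ^ 2 + √n * J 4 := by
      have h : (n : ℝ) * (√(n : ℝ))⁻¹ = √n := by rw [← div_eq_mul_inv, div_sqrt]
      rw [mul_add, ← mul_assoc, h]
    have hθ4 : n * θ 4 = n * σ ^ 2 + √n * J 4 - (a * (β * J 2) + b * (J 3 / β)) := by
      rw [t4, mul_sub, hnJ]; field_simp
    rw [hθ4, hC, hD]
    -- The normal equations turn the two linear terms of `θ 4` into the quadratic form that
    -- separates the minimal residual sum from the true one.
    have f1 : √(n * log n) * (β * J 2) = (√(n * log n))⁻¹ * a *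
        ∑ i ∈ Finset.range n, ((v i).1)⁻¹ + (√n)⁻¹ * b * n := by linarith
    have f2 : √n * (J 3 / β) = (√(n * log n))⁻¹ * a * n +
        (√n)⁻¹ * b * ∑ i ∈ Finset.range n, (v i).1 := by linarith
    rw [f1, f2]
    linear_combination -hw
  refine isMLE_and_unique (zero_lt_one.trans hn) (fun i _ => hv i) ?_ ?_ ?_ r1 r2 ?_ r5 hυ
  · exact hk
  · rw [s1, s2]; exact hk'
  · rw [s1]; exact t1
  · rw [hSr, hSx]
    have : n * log n * R * (n * (sampleMeans β n J).1) - n ^ 2 =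
        n ^ 2 * log n * regDet β n J R := by
      rw [regDet]; field_simp
    have hp : 0 < n ^ 2 * log n * regDet β n J R := by positivity
    linarith

/-! ### Asymptotic expansion of the solution of the likelihood equations -/

section Expansion

variable {Ω : Type*} [MeasurableSpace Ω] {P : Measure Ω} {β : ℝ} {J : ℕ → Ω → Fin 5 → ℝ}
  {R : ℕ → Ω → ℝ}

lemma tendsto_inv_log_natCast : Tendsto (fun n : ℕ => (log (n : ℝ))⁻¹) atTop (𝓝 0) :=
  tendsto_inv_atTop_zero.comp (tendsto_log_atTop.comp tendsto_natCast_atTop_atTop)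

lemma tendsto_inv_sqrt_log_natCast : Tendsto (fun n : ℕ => (√(log (n : ℝ)))⁻¹) atTop (𝓝 0) :=
  tendsto_inv_atTop_zero.comp (tendsto_sqrt_atTop.comp
    (tendsto_log_atTop.comp tendsto_natCast_atTop_atTop))

lemma boundedInProb_meanFluctuation (hJ : ∀ j, BoundedInProb P (fun n ω => J n ω j)) :
    BoundedInProb P (fun n ω => ‖meanFluctuation β (J n ω)‖) := by
  have h1 : BoundedInProb P (fun n ω => (meanFluctuation β (J n ω)).1) := by
    refine (((hJ 0).const_mul (β / β ^ 2)).add ((hJ 1).const_mul (-(β ^ 2)⁻¹))).mono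
      fun n ω => le_of_eq ?_
    simp only [meanFluctuation]; ring_nf
  have h2 : BoundedInProb P (fun n ω => (meanFluctuation β (J n ω)).2) :=
    ((hJ 0).const_mul (deriv digamma 1 - 1)).add (h1.const_mul β)
  have h1' : BoundedInProb P (fun n ω => |(meanFluctuation β (J n ω)).1|) :=
    h1.mono fun n ω => by simp
  have h2' : BoundedInProb P (fun n ω => |(meanFluctuation β (J n ω)).2|) :=
    h2.mono fun n ω => by simp
  refine (h1'.add h2').mono fun n ω => ?_
  rw [abs_norm, abs_of_nonneg (by positivity), Prod.norm_def]
  exact max_le (le_add_of_nonneg_right (abs_nonneg _)) (le_add_of_nonneg_left (abs_nonneg _))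

lemma tendstoInMeasure_sampleMeans (hJ : ∀ j, BoundedInProb P (fun n ω => J n ω j)) :
    TendstoInMeasure P (fun n ω => sampleMeans β n (J n ω)) atTop
      (fun _ => (1 / β, digamma 1 - log β)) := by
  have h := tendstoInMeasure_comp_continuousAt
    (tendstoInMeasure_inv_sqrt_smul (boundedInProb_meanFluctuation (β := β) hJ))
    (g := fun p => ((1 / β, digamma 1 - log β) : ℝ × ℝ) + p) (by fun_prop)
  simpa [sampleMeans] using h

/-- The limit is `β * (1 / β)`, as the correction `1 / log n` disappears. -/
lemma tendstoInMeasure_regDet (hβ : 0 < β) (hJ : ∀ j, BoundedInProb P (fun n ω => J n ω j))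
    (hR : TendstoInMeasure P R atTop (fun _ => β)) :
    TendstoInMeasure P (fun n ω => regDet β n (J n ω) (R n ω)) atTop (fun _ => 1) := by
  have h := tendstoInMeasure_comp_continuousAt
    (tendstoInMeasure_prodMk_const hR (tendstoInMeasure_prodMk_const
      (tendstoInMeasure_sampleMeans (β := β) hJ)
      (tendstoInMeasure_of_tendsto tendsto_inv_log_natCast)))
    (g := fun p : ℝ × (ℝ × ℝ) × ℝ => p.1 * p.2.1.1 - p.2.2) (by fun_prop)
  have e : β * (1 / β) - 0 = 1 := by field_simp; ring
  simp only [e] at h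
  exact h

lemma hasFDerivAt_shape {k : ℝ → ℝ} (hβ : 0 < β)
    (hk : HasDerivAt k (1 - deriv digamma 1)⁻¹ (-digamma 1)) :
    HasFDerivAt (fun p : ℝ × ℝ => k (log p.1 - p.2))
      ((1 - deriv digamma 1)⁻¹ • (β • ContinuousLinearMap.fst ℝ ℝ ℝ -
        ContinuousLinearMap.snd ℝ ℝ ℝ)) (1 / β, digamma 1 - log β) := by
  have h1 : HasFDerivAt (fun p : ℝ × ℝ => log p.1 - p.2) (β • ContinuousLinearMap.fst ℝ ℝ ℝ -
      ContinuousLinearMap.snd ℝ ℝ ℝ) (1 / β, digamma 1 - log β) := by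
    have := (hasFDerivAt_fst (𝕜 := ℝ) (p := ((1 / β, digamma 1 - log β) : ℝ × ℝ))).log
      (by positivity)
    have e : ((1 / β, digamma 1 - log β) : ℝ × ℝ).1⁻¹ = β := by simp
    rw [e] at this
    exact this.sub hasFDerivAt_snd
  have e1 : log (1 / β) - (digamma 1 - log β) = -digamma 1 := by
    rw [one_div, log_inv]; ring
  refine HasDerivAt.comp_hasFDerivAt (h₂ := k) _ ?_ h1
  change HasDerivAt k _ (log (1 / β) - (digamma 1 - log β))
  rw [e1]
  exact hk

/-- The gradient at the limiting means sends the fluctuation `(A, B)` to `(1 - ψ'(1))⁻¹ * (β * A -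
B)`, which is exactly `J 0`. -/
lemma tendstoInMeasure_shape {k : ℝ → ℝ} (hβ : 0 < β) (hk1 : k (-digamma 1) = 1)
    (hk : HasDerivAt k (1 - deriv digamma 1)⁻¹ (-digamma 1))
    (hJ : ∀ j, BoundedInProb P (fun n ω => J n ω j)) :
    TendstoInMeasure P (fun (n : ℕ) ω => √n * (k (log (sampleMeans β n (J n ω)).1 -
      (sampleMeans β n (J n ω)).2) - 1) - J n ω 0) atTop (fun _ => 0) := by
  have hD := inv_lt_deriv_digamma one_pos
  rw [inv_one] at hD
  have hD0 : 1 - deriv digamma 1 ≠ 0 := by linarith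
  have h := tendstoInMeasure_delta (hasFDerivAt_shape hβ hk) (boundedInProb_meanFluctuation (β := β) hJ)
  refine h.congr (fun n => ae_of_all _ fun ω => ?_) EventuallyEq.rfl
  have e1 : log (1 / β) - (digamma 1 - log β) = -digamma 1 := by
    rw [one_div, log_inv]; ring
  simp only [e1, hk1]
  congr 1
  simp [meanFluctuation]
  field_simp
  ring

/-- The product rule for shape times inverse mean gives the linear part `β * J 0 - β ^ 2 * A`, where
`A` is the fluctuation of the mean of `X`; this is `J 1`. -/
lemma tendstoInMeasure_rate {k : ℝ → ℝ} (hβ : 0 < β) (hk1 : k (-digamma 1) = 1)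
    (hk : HasDerivAt k (1 - deriv digamma 1)⁻¹ (-digamma 1))
    (hJ : ∀ j, BoundedInProb P (fun n ω => J n ω j)) :
    TendstoInMeasure P (fun (n : ℕ) ω => √n * (k (log (sampleMeans β n (J n ω)).1 -
      (sampleMeans β n (J n ω)).2) / (sampleMeans β n (J n ω)).1 - β) - J n ω 1) atTop
      (fun _ => 0) := by
  have hD := inv_lt_deriv_digamma one_pos
  rw [inv_one] at hD
  have hD0 : 1 - deriv digamma 1 ≠ 0 := by linarith
  have hinv : HasFDerivAt (fun p : ℝ × ℝ => p.1⁻¹)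
      ((-((1 / β) ^ 2)⁻¹) • ContinuousLinearMap.fst ℝ ℝ ℝ) (1 / β, digamma 1 - log β) :=
    HasDerivAt.comp_hasFDerivAt (h₂ := fun x : ℝ => x⁻¹) ((1 / β, digamma 1 - log β) : ℝ × ℝ)
      (hasDerivAt_inv (by positivity)) hasFDerivAt_fst
  have h := tendstoInMeasure_delta ((hasFDerivAt_shape hβ hk).mul hinv)
    (boundedInProb_meanFluctuation (β := β) hJ)
  refine h.congr (fun n => ae_of_all _ fun ω => ?_) EventuallyEq.rfl
  have e1 : log (1 / β) - (digamma 1 - log β) = -digamma 1 := by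
    rw [one_div, log_inv]; ring
  simp only [Pi.mul_apply, e1, hk1]
  congr 1
  · simp [sampleMeans, div_eq_mul_inv]
  · simp [meanFluctuation]
    field_simp
    ring

/-- The error is `J 2 * o_P(1) + J 3 * o_P(1)`: the own coefficient tends to one, and the
coefficient of `J 3` is of order `1 / √(log n)`. -/
lemma tendstoInMeasure_interceptError (hβ : 0 < β)
    (hJ : ∀ j, BoundedInProb P (fun n ω => J n ω j))
    (hR : TendstoInMeasure P R atTop (fun _ => β)) :
    TendstoInMeasure P (fun n ω => interceptError β n (J n ω) (R n ω) - J n ω 2) atTop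
      (fun _ => 0) := by
  have hd := tendstoInMeasure_regDet hβ hJ hR
  have h1 := tendstoInMeasure_comp_continuousAt
    (tendstoInMeasure_prodMk_const (tendstoInMeasure_sampleMeans (β := β) hJ) hd)
    (g := fun p : (ℝ × ℝ) × ℝ => β * p.1.1 / p.2 - 1)
    (ContinuousAt.sub (ContinuousAt.div (by fun_prop) (by fun_prop) one_ne_zero) (by fun_prop))
  have h2 := tendstoInMeasure_comp_continuousAt
    (tendstoInMeasure_prodMk_const (tendstoInMeasure_of_tendsto tendsto_inv_sqrt_log_natCast) hd)
    (g := fun p : ℝ × ℝ => -(β⁻¹ * p.1 / p.2))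
    (ContinuousAt.neg (ContinuousAt.div (by fun_prop) (by fun_prop) one_ne_zero))
  have e1 : β * (1 / β) / 1 - 1 = 0 := by field_simp; ring
  have e2 : -(β⁻¹ * 0 / 1) = 0 := by simp
  simp only [e1] at h1
  simp only [e2] at h2
  refine (tendstoInMeasure_add_zero_zero ((hJ 2).mul_tendstoInMeasure h1)
    ((hJ 3).mul_tendstoInMeasure h2)).congr (fun n => ae_of_all _ fun ω => ?_) EventuallyEq.rfl
  simp only [interceptError]
  ring

lemma tendstoInMeasure_slopeError (hβ : 0 < β)
    (hJ : ∀ j, BoundedInProb P (fun n ω => J n ω j))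
    (hR : TendstoInMeasure P R atTop (fun _ => β)) :
    TendstoInMeasure P (fun n ω => slopeError β n (J n ω) (R n ω) - J n ω 3) atTop
      (fun _ => 0) := by
  have hd := tendstoInMeasure_regDet hβ hJ hR
  have h1 := tendstoInMeasure_comp_continuousAt (tendstoInMeasure_prodMk_const hR hd)
    (g := fun p : ℝ × ℝ => β⁻¹ * p.1 / p.2 - 1)
    (ContinuousAt.sub (ContinuousAt.div (by fun_prop) (by fun_prop) one_ne_zero) (by fun_prop))
  have h2 := tendstoInMeasure_comp_continuousAt
    (tendstoInMeasure_prodMk_const (tendstoInMeasure_of_tendsto tendsto_inv_sqrt_log_natCast) hd)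
    (g := fun p : ℝ × ℝ => -(β * p.1 / p.2))
    (ContinuousAt.neg (ContinuousAt.div (by fun_prop) (by fun_prop) one_ne_zero))
  have e1 : β⁻¹ * β / 1 - 1 = 0 := by field_simp; ring
  have e2 : -(β * 0 / 1) = 0 := by simp
  simp only [e1] at h1
  simp only [e2] at h2
  refine (tendstoInMeasure_add_zero_zero ((hJ 3).mul_tendstoInMeasure h1)
    ((hJ 2).mul_tendstoInMeasure h2)).congr (fun n => ae_of_all _ fun ω => ?_) EventuallyEq.rfl
  simp only [slopeError]
  ring

lemma tendstoInMeasure_inv_sqrt_mul_mul {f g : ℕ → Ω → ℝ} (hg : BoundedInProb P g)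
    (hfg : TendstoInMeasure P (fun n ω => f n ω - g n ω) atTop (fun _ => 0)) :
    TendstoInMeasure P (fun (n : ℕ) ω => (√n)⁻¹ * (f n ω * g n ω)) atTop (fun _ => 0) := by
  have hs : TendstoInMeasure P (fun (n : ℕ) (_ : Ω) => (√n)⁻¹) atTop (fun _ => 0) :=
    tendstoInMeasure_of_tendsto tendsto_inv_sqrt_natCast
  have h1 := tendstoInMeasure_comp_continuousAt (tendstoInMeasure_prodMk_const hs hfg)
    (g := fun p : ℝ × ℝ => p.1 * p.2) (by fun_prop)
  simp only [mul_zero] at h1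
  refine (tendstoInMeasure_add_zero_zero (hg.mul_tendstoInMeasure h1)
    ((hg.mul hg).mul_tendstoInMeasure hs)).congr (fun n => ae_of_all _ fun ω => ?_)
    EventuallyEq.rfl
  ring

/-- Estimating `(δ, μ)` lowers the residual sum by an amount bounded in probability, so its effect
on the normalized variance is of order `1 / √n`. -/
lemma tendstoInMeasure_variance (k : ℝ → ℝ) (δ μ σ : ℝ) (hβ : 0 < β)
    (hJ : ∀ j, BoundedInProb P (fun n ω => J n ω j))
    (hR : TendstoInMeasure P R atTop (fun _ => β)) :
    TendstoInMeasure P (fun (n : ℕ) ω => √n * (likelihoodRoot k β δ μ σ n (J n ω) (R n ω) 4 -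
      σ ^ 2) - J n ω 4) atTop (fun _ => 0) := by
  have h1 := tendstoInMeasure_inv_sqrt_mul_mul (hJ 2) (tendstoInMeasure_interceptError hβ hJ hR)
  have h2 := tendstoInMeasure_inv_sqrt_mul_mul (hJ 3) (tendstoInMeasure_slopeError hβ hJ hR)
  refine (tendstoInMeasure_add_zero_zero (tendstoInMeasure_const_mul_zero h1 (-β))
    (tendstoInMeasure_const_mul_zero h2 (-β⁻¹))).congr' ?_ EventuallyEq.rfl
  filter_upwards [eventually_gt_atTop 0] with n hn
  refine ae_of_all _ fun ω => ?_
  have hn0 : (0 : ℝ) < n := by exact_mod_cast hn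
  have hs : √(n : ℝ) ≠ 0 := by positivity
  have h : (n : ℝ)⁻¹ = (√(n : ℝ))⁻¹ * (√(n : ℝ))⁻¹ := by rw [← mul_inv, mul_self_sqrt hn0.le]
  simp only [likelihoodRoot, Matrix.cons_val, div_eq_mul_inv, h]
  field_simp
  ring

lemma tendstoInMeasure_varianceRoot (k : ℝ → ℝ) (δ μ σ : ℝ) (hβ : 0 < β)
    (hJ : ∀ j, BoundedInProb P (fun n ω => J n ω j))
    (hR : TendstoInMeasure P R atTop (fun _ => β)) :
    TendstoInMeasure P (fun (n : ℕ) ω => likelihoodRoot k β δ μ σ n (J n ω) (R n ω) 4) atTop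
      (fun _ => σ ^ 2) := by
  have hs : TendstoInMeasure P (fun (n : ℕ) (_ : Ω) => (√n)⁻¹) atTop (fun _ => 0) :=
    tendstoInMeasure_of_tendsto tendsto_inv_sqrt_natCast
  have h := tendstoInMeasure_comp_continuousAt
    (tendstoInMeasure_prodMk_const (tendstoInMeasure_prodMk_const hs
      (tendstoInMeasure_variance k δ μ σ hβ hJ hR)) ((hJ 4).mul_tendstoInMeasure hs))
    (g := fun p : (ℝ × ℝ) × ℝ => σ ^ 2 + (p.1.1 * p.1.2 + p.2)) (by fun_prop)
  simp only [mul_zero, add_zero] at h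
  refine h.congr' ?_ EventuallyEq.rfl
  filter_upwards [eventually_gt_atTop 0] with n hn
  refine ae_of_all _ fun ω => ?_
  have hs : √(n : ℝ) ≠ 0 := by positivity
  simp only
  field_simp
  ring

lemma scaling_mulVec (n : ℕ) (w : Fin 5 → ℝ) (j : Fin 5) :
    (scaling n *ᵥ w) j = √n * (![1, 1, √(log n), 1, 1] j * w j) := by
  simp [scaling, smul_mulVec, mulVec_diagonal]

/-- The normalized error of the solution of the likelihood equations is asymptotically the sum of
the influence functions. -/
lemma tendstoInMeasure_scaling_likelihoodRoot {k : ℝ → ℝ} (δ μ σ : ℝ) (hβ : 0 < β)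
    (hk1 : k (-digamma 1) = 1) (hk : HasDerivAt k (1 - deriv digamma 1)⁻¹ (-digamma 1))
    (hJ : ∀ j, BoundedInProb P (fun n ω => J n ω j))
    (hR : TendstoInMeasure P R atTop (fun _ => β)) :
    TendstoInMeasure P (fun n ω => scaling n *ᵥ (likelihoodRoot k β δ μ σ n (J n ω) (R n ω) -
      ![1, β, δ, μ, σ ^ 2]) - J n ω) atTop 0 := by
  refine tendstoInMeasure_pi_zero fun j => ?_
  simp only [Pi.sub_apply, scaling_mulVec]
  fin_cases j
  · simpa [likelihoodRoot] using tendstoInMeasure_shape hβ hk1 hk hJ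
  · simpa [likelihoodRoot] using tendstoInMeasure_rate hβ hk1 hk hJ
  · refine (tendstoInMeasure_interceptError hβ hJ hR).congr' ?_ EventuallyEq.rfl
    filter_upwards [eventually_gt_atTop 1] with n hn
    refine ae_of_all _ fun ω => ?_
    have hn0 : (0 : ℝ) < n := by exact_mod_cast (zero_lt_one.trans hn)
    have hlog : 0 < log (n : ℝ) := log_pos (by exact_mod_cast hn)
    simp [likelihoodRoot, sqrt_mul hn0.le]
    field_simp
  · refine (tendstoInMeasure_slopeError hβ hJ hR).congr' ?_ EventuallyEq.rfl
    filter_upwards [eventually_gt_atTop 1] with n hn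
    refine ae_of_all _ fun ω => ?_
    have hn0 : (0 : ℝ) < n := by exact_mod_cast (zero_lt_one.trans hn)
    simp [likelihoodRoot]
    field_simp
  · simpa using tendstoInMeasure_variance k δ μ σ hβ hJ hR

/-- With probability tending to one, the conditions under which the likelihood equations have a
solution which is the maximum likelihood estimate are satisfied. -/
lemma tendsto_measure_likelihood_regular {k : ℝ → ℝ} (δ μ : ℝ) {σ : ℝ} (hβ : 0 < β) (hσ : 0 < σ)
    (hk : ∀ᶠ c in 𝓝 (-digamma 1), 0 < k c ∧ log (k c) - digamma (k c) = c)
    (hJ : ∀ j, BoundedInProb P (fun n ω => J n ω j))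
    (hR : TendstoInMeasure P R atTop (fun _ => β)) :
    Tendsto (fun n => P {ω | (0 < k (log (sampleMeans β n (J n ω)).1 -
        (sampleMeans β n (J n ω)).2) ∧
      log (k (log (sampleMeans β n (J n ω)).1 - (sampleMeans β n (J n ω)).2)) -
        digamma (k (log (sampleMeans β n (J n ω)).1 - (sampleMeans β n (J n ω)).2)) =
        log (sampleMeans β n (J n ω)).1 - (sampleMeans β n (J n ω)).2) ∧
      0 < regDet β n (J n ω) (R n ω) ∧
      0 < likelihoodRoot k β δ μ σ n (J n ω) (R n ω) 4}ᶜ) atTop (𝓝 0) := by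
  have hυ := tendstoInMeasure_varianceRoot k δ μ σ hβ hJ hR
  have hd := tendstoInMeasure_prodMk_const (tendstoInMeasure_regDet hβ hJ hR) hυ
  have h := tendstoInMeasure_prodMk_const (tendstoInMeasure_sampleMeans (β := β) hJ) hd
  have hc : ContinuousAt (fun p : ℝ × ℝ => log p.1 - p.2) (1 / β, digamma 1 - log β) :=
    ContinuousAt.sub (ContinuousAt.log continuousAt_fst (one_div_pos.2 hβ).ne') continuousAt_snd
  have e1 : log (1 / β) - (digamma 1 - log β) = -digamma 1 := by
    rw [one_div, log_inv]; ring
  have hc' : Tendsto (fun p : ℝ × ℝ => log p.1 - p.2) (𝓝 (1 / β, digamma 1 - log β))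
      (𝓝 (-digamma 1)) := e1 ▸ hc
  have hU : {p : (ℝ × ℝ) × ℝ × ℝ | (0 < k (log p.1.1 - p.1.2) ∧
      log (k (log p.1.1 - p.1.2)) - digamma (k (log p.1.1 - p.1.2)) = log p.1.1 - p.1.2) ∧
      0 < p.2.1 ∧ 0 < p.2.2} ∈ 𝓝 ((1 / β, digamma 1 - log β), ((1 : ℝ), σ ^ 2)) :=
    prod_mem_nhds (hc'.eventually hk)
      (prod_mem_nhds (lt_mem_nhds one_pos) (lt_mem_nhds (pow_pos hσ 2)))
  have h' := tendsto_measure_notMem h hU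
  exact h'

end Expansion

/-! ### Standardized observations -/

/-- The pair `(X, Z)` recovered from an observation `(X, Y)` with `Y = δ + μ X + σ √X Z`. -/
noncomputable def standardize (δ μ σ : ℝ) (p : ℝ × ℝ) : ℝ × ℝ :=
  (p.1, (p.2 - δ - μ * p.1) / (σ * √p.1))

lemma measurable_standardize (δ μ σ : ℝ) : Measurable (standardize δ μ σ) := by
  unfold standardize; fun_prop

lemma eq_of_standardize (δ μ : ℝ) {σ : ℝ} (hσ : σ ≠ 0) {p : ℝ × ℝ} (hp : 0 < p.1) :
    p.2 = δ + μ * (standardize δ μ σ p).1 +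
      σ * √(standardize δ μ σ p).1 * (standardize δ μ σ p).2 := by
  have : √p.1 ≠ 0 := by positivity
  simp only [standardize]
  field_simp
  ring

/-- The hypotheses concern only the law of `(X, Y)`, without providing `Z`; inverting the defining
map almost surely recovers an exponential and an independent standard normal variable from the data.
-/
lemma hasLaw_standardize {β : ℝ} (δ μ : ℝ) {σ : ℝ} (hβ : 0 < β) (hσ : σ ≠ 0) :
    HasLaw (standardize δ μ σ) (expNormal β) (law 1 β δ μ σ) where
  aemeasurable := (measurable_standardize δ μ σ).aemeasurable
  map_eq := by
    have hm : Measurable fun p : ℝ × ℝ => (p.1, δ + μ * p.1 + σ * √p.1 * p.2) := by fun_prop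
    rw [law, Measure.map_map (measurable_standardize δ μ σ) hm]
    refine (Measure.map_congr ?_).trans Measure.map_id
    filter_upwards [ae_expNormal_pos hβ] with p hp
    have : √p.1 ≠ 0 := by positivity
    ext
    · rfl
    · simp only [standardize, Function.comp_apply, id]
      field_simp
      ring

end BGGL

theorem theorem4p4 {Ω : Type*} [MeasurableSpace Ω] (P : Measure Ω) [IsProbabilityMeasure P]
    (β δ μ σ : ℝ) (hβ : 0 < β) (hσ : 0 < σ)
    (X Y : ℕ → Ω → ℝ)
    (h_indep : iIndepFun (fun i ω => (X i ω, Y i ω)) P)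
    (h_law : ∀ i, HasLaw (fun ω => (X i ω, Y i ω)) (BGGL.law 1 β δ μ σ) P)
    (θhat : ℕ → Ω → (Fin 5 → ℝ))
    (h_meas : ∀ n, AEMeasurable (θhat n) P)
    (h_mle : ∀ n, ∀ᵐ ω ∂P,
      (∃ θ, BGGL.IsMLE n (fun i => X i ω) (fun i => Y i ω) θ) →
        BGGL.IsMLE n (fun i => X i ω) (fun i => Y i ω) (θhat n ω)) :
    TendstoInDistribution
      (fun (n : ℕ) ω => BGGL.scaling n *ᵥ (θhat n ω - ![1, β, δ, μ, σ ^ 2]))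
      atTop BGGL.assemble (fun _ => P) (BGGL.limitBlocks β σ) ∧
    TendstoInDistribution
      (fun (n : ℕ) ω => ((n : ℝ) * Real.log n)⁻¹ * ∑ i ∈ Finset.range n, (X i ω)⁻¹)
      atTop (fun _ : Ω => β) (fun _ => P) P := by
  have := isProbabilityMeasure_gammaMeasure one_pos hβ
  set V : ℕ → Ω → ℝ × ℝ := fun i ω => BGGL.standardize δ μ σ (X i ω, Y i ω) with hVdef
  have hVlaw : ∀ i, HasLaw (V i) (BGGL.expNormal β) P := fun i =>
    (BGGL.hasLaw_standardize δ μ hβ hσ.ne').comp (h_law i)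
  have hV : iIndepFun V P :=
    h_indep.comp (fun _ => BGGL.standardize δ μ σ) fun _ => BGGL.measurable_standardize δ μ σ
  have hXlaw : ∀ i, HasLaw (X i) (gammaMeasure 1 β) P := fun i =>
    (measurePreserving_fst (μ := gammaMeasure 1 β) (ν := gaussianReal 0 1)).hasLaw.comp (hVlaw i)
  have hX : iIndepFun X P := h_indep.comp (fun _ => Prod.fst) fun _ => measurable_fst
  have hpos : ∀ᵐ ω ∂P, ∀ i, 0 < X i ω := ae_all_iff.2 fun i =>
    ((hXlaw i).ae_iff (p := fun x => 0 < x)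
      (measurableSet_setOfPred.1 measurableSet_Ioi)).2 (BGGL.ae_gammaMeasure_pos 1 β)
  have hR := BGGL.tendstoInMeasure_sum_inv hβ hX hXlaw
  have hdist := BGGL.tendstoInDistribution_sum_influence hβ hσ hV hVlaw
  set J : ℕ → Ω → Fin 5 → ℝ :=
    fun n ω => ∑ i ∈ Finset.range n, BGGL.influence β σ n (V i ω) with hJdef
  set R : ℕ → Ω → ℝ :=
    fun n ω => ((n : ℝ) * Real.log n)⁻¹ * ∑ i ∈ Finset.range n, (X i ω)⁻¹ with hRdef
  have hJ : ∀ j, BGGL.BoundedInProb P (fun n ω => J n ω j) := fun j =>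
    (BGGL.boundedInProb_of_tendstoInDistribution hdist).mono fun n ω => by
      rw [abs_norm]; exact norm_le_pi_norm (J n ω) j
  obtain ⟨k, hk1, hk, hk'⟩ := BGGL.exists_inverse_log_sub_digamma
  -- Slutsky: `J` converges in distribution and the normalized error differs from it by a term
  -- tending to zero in probability. The second claim is convergence in probability to a constant.
  refine ⟨tendstoInDistribution_of_tendstoInMeasure_sub (X := J) _ _ hdist ?_ fun n => ?_,
    hR.tendstoInDistribution fun n => ?_⟩
  -- On the regular events the explicit root is a maximizer, so `θhat` must be one as well, and
  -- uniqueness identifies the two. Outside these events the arbitrary values of `θhat` do not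
  -- matter.
  · refine BGGL.tendstoInMeasure_of_agree
      (BGGL.tendsto_measure_likelihood_regular δ μ hβ hσ hk' hJ hR) ?_
      (BGGL.tendstoInMeasure_scaling_likelihoodRoot δ μ σ hβ hk1 hk hJ hR)
    filter_upwards [eventually_gt_atTop 1] with n hn
    filter_upwards [hpos, h_mle n] with ω hω hmle hs
    obtain ⟨⟨hs1, hs2⟩, hs3, hs4⟩ := hs
    obtain ⟨hex, huniq⟩ := BGGL.isMLE_likelihoodRoot hβ hn (v := fun i => V i ω)
      (y := fun i => Y i ω) hω (fun i =>
        BGGL.eq_of_standardize δ μ hσ.ne' (p := (X i ω, Y i ω)) (hω i))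
      (J := J n ω) (R := R n ω) rfl rfl hs1 hs2 hs3 hs4
    simp only [Pi.sub_apply, huniq _ (hmle ⟨_, hex⟩)]
  · exact (Continuous.measurable (by fun_prop : Continuous fun w : Fin 5 → ℝ =>
      BGGL.scaling n *ᵥ (w - ![1, β, δ, μ, σ ^ 2]))).comp_aemeasurable (h_meas n)
  · exact (Finset.aemeasurable_fun_sum _ fun i _ =>
      (hXlaw i).aemeasurable.inv).const_mul _
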